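/- \textbf{Model.} In the Massively Parallel Computation (MPC) model, $p$ servers compute in synchronous rounds. In the communication phase of a round every server sends a bit string to every server; then it computes locally, without restriction. The servers share a random seed, chosen uniformly from a finite set, and the messages and the output of a server are arbitrary functions of the seed, the statistics below, its own identity, the part of the input it stores, and the messages it has received so far. The \emph{load} of an execution is the maximum number of bits received by any server in any round. The result is the union of the outputs of the $p$ servers after the last round. \textbf{Query and input.} For $k\ge 2$, the line query is $$L_k(x_0,\dots,x_k)=S_1(x_0,x_1),\,S_2(x_1,x_2),\,\dots,\,S_k(x_{k-1},x_k),$$ whose answer is the set of all $(x_0,\dots,x_k)$ with $(x_{j-1},x_j)\in S_j$ for $j=1,\dots,k$. The input consists of binary relations $S_1,\dots,S_k$ over a domain of size $n$, each with exactly $m\ge p$ tuples, hence of size $M=2m\log_2 n$ bits. The $km$ input tuples are initially partitioned in an arbitrary way among the servers, each server storing at most $\lceil km/p\rceil$ of them. The algorithm knows $p$, $m$, $n$ and the heavy-hitter statistics: for each relation and each of its two attributes, the values that occur there in at least $m/p$ tuples, with their frequencies. \textbf{Statement.} For every $k\ge 2$ there is a randomized MPC algorithm (a protocol for each $p,m,n$)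 which always uses at most $\lfloor k/2\rfloor$ rounds, always computes $L_k$ correctly for all $p \geq 1$, $m\ge p$, all such inputs and all such initial partitions, and has load $$\tilde O\!\left(\frac{M}{p^{1/\lceil (k+1)/2\rceil}}\right)$$ with high probability, where $\tilde O$ hides a polylogarithmic factor in $p$. Precisely: there is a constant $c$ depending only on $k$, and for every $a\in\mathbb N$ a constant $C$ depending only on $k$ and $a$, such that for all $p\ge 1$, $m\ge p$, $n$, every such input and every such initial partition, with probability at least $1-p^{-a}$ the load is at most $$C\,(1+\ln p)^c\,\frac{M}{p^{1/\lceil (k+1)/2\rceil}}.$$ -/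

import Mathlib

/-- A protocol in the Massively Parallel Computation model with `p` servers, where every server
initially holds a local input of type `X`, the data statistics of type `St` are available to all
servers, and every server finally produces a finite set of answers of type `Y`.

The protocol is randomized: all servers share a seed drawn uniformly from the finite nonempty
set `Seed` (the choice of the hash functions). In the communication phase of each round every
server sends a bit string to every server; what it sends is an arbitrary function of what it knows,
namely the seed, the statistics, its own name, its local input, and the list of the messages it
received in all the previous rounds (one entry for each round, indexed by the sender; the number of
the round is determined by the length of the list). After the last round each server computes its
output from the same kind of knowledge. Local computation is unrestricted. -/
structure MPCProtocol (p : ℕ) (X St Y : Type) where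
  rounds : ℕ
  Seed : Type
  [seedFintype : Fintype Seed]
  [seedNonempty : Nonempty Seed]
  send : Seed → St → (self : Fin p) → X → List (Fin p → List Bool) →
    (dest : Fin p) → List Bool
  output : Seed → St → (self : Fin p) → X → List (Fin p → List Bool) → Finset Y

namespace MPCProtocol

variable {p : ℕ} {X St Y : Type}

/-- The messages received by each server during the first `r` rounds, in the order of the rounds,
when the seed is `ω`, the statistics are `st` and server `s` holds the local input `x s`. -/
def received (A : MPCProtocol p X St Y) (ω : A.Seed) (st : St) (x : Fin p → X) :
    ℕ → Fin p → List (Fin p → List Bool)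
  | 0, _ => []
  | r + 1, s => received A ω st x r s ++
      [fun s' => A.send ω st s' (x s') (received A ω st x r s') s]

/-- The number of bits received by server `s` during the round that follows the first `r` ones. -/
def bitsReceived (A : MPCProtocol p X St Y) (ω : A.Seed) (st : St) (x : Fin p → X)
    (r : ℕ) (s : Fin p) : ℕ :=
  ∑ s' : Fin p, (A.send ω st s' (x s') (A.received ω st x r s') s).length

/-- The maximum load: the maximum number of bits received by any server during any round. -/
def load (A : MPCProtocol p X St Y) (ω : A.Seed) (st : St) (x : Fin p → X) : ℕ :=
  (Finset.range A.rounds).sup fun r => Finset.univ.sup fun s => A.bitsReceived ω st x r s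

/-- The union of the outputs of the `p` servers at the end of the execution. -/
def result (A : MPCProtocol p X St Y) (ω : A.Seed) (st : St) (x : Fin p → X) : Set Y :=
  ⋃ s : Fin p, (A.output ω st s (x s) (A.received ω st x A.rounds s) : Set Y)

/-- The probability of an event over the uniformly random seed. -/
noncomputable def prob (A : MPCProtocol p X St Y) (E : Set A.Seed) : ℝ :=
  (E.ncard : ℝ) / (Nat.card A.Seed : ℝ)

end MPCProtocol

/-- An instance for `k` binary relation symbols over the domain of size `n`. -/
abbrev BinaryInstance (k n : ℕ) : Type := Fin k → Finset (Fin n × Fin n)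

/-- The answer to the line query
`L_k(x_0, ..., x_k) = S_1(x_0, x_1), S_2(x_1, x_2), ..., S_k(x_{k-1}, x_k)`,
where `S j` for `j : Fin k` is the relation of the atom on the variables `x_j, x_{j+1}`. -/
def lineQuery {k n : ℕ} (S : BinaryInstance k n) : Set (Fin (k + 1) → Fin n) :=
  {x | ∀ j : Fin k, (x j.castSucc, x j.succ) ∈ S j}

/-- The frequency of the value `v` in the first attribute of the relation `R`. -/
def degreeFst {n : ℕ} (R : Finset (Fin n × Fin n)) (v : Fin n) : ℕ :=
  (R.filter fun t => t.1 = v).card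

/-- The frequency of the value `v` in the second attribute of the relation `R`. -/
def degreeSnd {n : ℕ} (R : Finset (Fin n × Fin n)) (v : Fin n) : ℕ :=
  (R.filter fun t => t.2 = v).card

/-- Heavy hitter statistics: a number for every relation, attribute and value. -/
structure HeavyStats (k n : ℕ) where
  fst : Fin k → Fin n → ℕ
  snd : Fin k → Fin n → ℕ

/-- The statistics of an instance on `p` servers: the heavy hitters, that is, the values
whose frequency in an attribute of a relation with `m` tuples is at least `m / p`, with their
frequencies. All other values are reported as `0`. -/
def heavyStats {k n : ℕ} (p : ℕ) (S : BinaryInstance k n) : HeavyStats k n where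
  fst j v := if (S j).card ≤ p * degreeFst (S j) v then degreeFst (S j) v else 0
  snd j v := if (S j).card ≤ p * degreeSnd (S j) v then degreeSnd (S j) v else 0

/-- The part of the instance that is initially stored at server `s`, when the tuple `t` of the
`j`-th relation is stored at the server `owner j t`. -/
def localPart {k n p : ℕ} (S : BinaryInstance k n) (owner : Fin k → Fin n × Fin n → Fin p)
    (s : Fin p) : BinaryInstance k n :=
  fun j => (S j).filter fun t => owner j t = s

/-- The initial partition is uniform: no server stores more than its share of the input tuples,
rounded up. -/
def IsUniformPartition {k n p : ℕ} (S : BinaryInstance k n)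
    (owner : Fin k → Fin n × Fin n → Fin p) : Prop :=
  ∀ s : Fin p, ∑ j, (localPart S owner s j).card ≤ (∑ j, (S j).card) ⌈/⌉ p

/-- Protocols with `p` servers for the line query of length `k` over the domain of size `n`. -/
abbrev LineProtocol (k p n : ℕ) : Type 1 :=
  MPCProtocol p (BinaryInstance k n) (HeavyStats k n) (Fin (k + 1) → Fin n)

/-- The size in bits of a binary relation with `m` tuples over a domain of size `n`. -/
noncomputable def relationBits (m n : ℕ) : ℝ := 2 * m * Real.logb 2 n

open Function

/-! Put `j = k / 2`, so that the root in the load is the `(j + 1)`-th. Arrange `q ^ (j + 1) ≤ p`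
servers in a grid with `j + 1` axes, where `q` is at least half of `p ^ (1 / (j + 1))`. Every other
relation of the path is some `E i` and owns an axis; the ones in between are the `O i`. For even `k`
the last relation serves twice, as `O (j - 1)` and, reversed, as `E j`. It suffices that each server
receives about `m / q` tuples of each relation, up to a logarithm.

For `i < j`, split `E i` along its axis by its second attribute. A light value is hashed to one
coordinate; a heavy value gets dedicated coordinates, enough for its frequency, and its tuples are
spread over them. An answer is found at the server whose coordinates are the places of its tuples.
If the value shared by `E i` and `O i` is light, its tuples in `O i` are hashed along with it. If it
is heavy, copying them to all its coordinates could be too expensive. But a coordinate is dedicated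
to only one value `v`, so there `O i` shrinks to a set of second attributes, that is, to a filter on
`E (i + 1)`. An extra first round applies this filter with `E (i + 1)` split by its first attribute;
the last round moves the surviving tuples, as marks, to their places by the second attribute. `E j`
is split by its first attribute anyway, so its filter needs no extra round. Hence `min j 2` rounds
suffice. `isAnswer_lastReceived` and `exists_isAnswer_lastReceived` give correctness.

For the load, each count at a coordinate is a sum of independent hits weighted by fibre sizes of
order `m / q`. An exponential moment bound (`ncard_many_hits_le`) and a union bound
(`le_ncard_isBalanced`) keep all counts below a logarithmic multiple of `m / q`. The failure
exponent enters only this analysis, not the protocol. -/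

/-! ### Encoding finite sets as bit strings. -/

theorem List.flatMap_injective_of_length_eq {α β : Type*} {c : α → List β} {w : ℕ} (hw : 0 < w)
    (hc : ∀ a, (c a).length = w) (hi : Injective c) :
    Injective fun l : List α => l.flatMap c := by
  intro l₁
  induction l₁ with
  | nil =>
    intro l₂ h
    cases l₂ with
    | nil => rfl
    | cons b l =>
      have := congrArg List.length h
      simp [hc] at this
      omega
  | cons a l ih =>
    intro l₂ h
    cases l₂ with
    | nil =>
      have := congrArg List.length h
      simp [hc] at this
      omega
    | cons b l' =>
      simp only [List.flatMap_cons] at h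
      obtain ⟨h1, h2⟩ := List.append_inj h (by simp [hc])
      rw [hi h1, ih h2]

/-- The concatenation of the codes of the elements of a finite set. -/
noncomputable def encodeFinset {α : Type*} {w : ℕ} (code : α ↪ (Fin w → Bool)) (F : Finset α) :
    List Bool :=
  F.toList.flatMap fun a => List.ofFn (code a)

theorem length_encodeFinset {α : Type*} {w : ℕ} (code : α ↪ (Fin w → Bool)) (F : Finset α) :
    (encodeFinset code F).length = F.card * w := by
  simp [encodeFinset, List.length_flatMap]

/-- Code words of one positive length can be split off unambiguously, so the list of elements is
recovered. With `w = 0` every set would have the empty code. -/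
theorem encodeFinset_injective {α : Type*} {w : ℕ} (hw : 0 < w) (code : α ↪ (Fin w → Bool)) :
    Injective (encodeFinset code) := by
  intro F G h
  have := List.flatMap_injective_of_length_eq hw (c := fun a => List.ofFn (code a))
    (by simp) (List.ofFn_injective.comp code.injective) h
  ext a
  rw [← Finset.mem_toList, this, Finset.mem_toList]

/-! ### Protocols that exchange sets of records, and translation of protocols. -/

namespace MPCProtocol

section OfSets

variable {p : ℕ} {X St Y α : Type} {w : ℕ}

open Classical in
/-- The union of the sets that are encoded in the messages of one round. -/
noncomputable def decodeRound (code : α ↪ (Fin w → Bool)) (f : Fin p → List Bool) : Finset α :=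
  Finset.univ.biUnion fun s => invFun (encodeFinset code) (f s)

/-- A protocol whose messages are finite sets of records of a fixed length; a server remembers
the union of the sets it received in each round. -/
noncomputable def ofSets (code : α ↪ (Fin w → Bool)) (rounds : ℕ) (Seed : Type) [Fintype Seed]
    [Nonempty Seed]
    (send : Seed → St → Fin p → X → List (Finset α) → Fin p → Finset α)
    (output : Seed → St → Fin p → X → List (Finset α) → Finset Y) : MPCProtocol p X St Y where
  rounds := rounds
  Seed := Seed
  send ω st s x l d := encodeFinset code (send ω st s x (l.map (decodeRound code)) d)
  output ω st s x l := output ω st s x (l.map (decodeRound code))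

open Classical in
/-- The sets received by each server during the first `r` rounds. -/
noncomputable def setHistory {Seed : Type}
    (send : Seed → St → Fin p → X → List (Finset α) → Fin p → Finset α)
    (ω : Seed) (st : St) (x : Fin p → X) : ℕ → Fin p → List (Finset α)
  | 0, _ => []
  | r + 1, s => setHistory send ω st x r s ++
      [Finset.univ.biUnion fun s' => send ω st s' (x s') (setHistory send ω st x r s') s]

variable (code : α ↪ (Fin w → Bool)) (rounds : ℕ) (Seed : Type) [Fintype Seed] [Nonempty Seed]
    (send : Seed → St → Fin p → X → List (Finset α) → Fin p → Finset α)
    (output : Seed → St → Fin p → X → List (Finset α) → Finset Y)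
    (ω : Seed) (st : St) (x : Fin p → X)

/-- Decoding inverts encoding, so from here on an execution can be studied through sets instead of
bit strings. -/
theorem received_ofSets (hw : 0 < w) (r : ℕ) (s : Fin p) :
    ((ofSets code rounds Seed send output).received ω st x r s).map (decodeRound code) =
      setHistory send ω st x r s := by
  induction r generalizing s with
  | zero => rfl
  | succ r ih =>
    simp only [received, setHistory, List.map_append, ih, List.map_cons, List.map_nil]
    congr 2
    simp only [decodeRound]
    congr 1
    funext s'
    simp only [ofSets]
    rw [leftInverse_invFun (encodeFinset_injective hw code)]
    congr 1
    exact ih s'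

theorem bitsReceived_ofSets (hw : 0 < w) (r : ℕ) (s : Fin p) :
    (ofSets code rounds Seed send output).bitsReceived ω st x r s =
      (∑ s', (send ω st s' (x s') (setHistory send ω st x r s') s).card) * w := by
  rw [Finset.sum_mul]
  refine Finset.sum_congr rfl fun s' _ => ?_
  rw [← received_ofSets code rounds Seed send output ω st x hw r s']
  exact length_encodeFinset _ _

theorem result_ofSets (hw : 0 < w) :
    (ofSets code rounds Seed send output).result ω st x =
      ⋃ s, (output ω st s (x s) (setHistory send ω st x rounds s) : Set Y) := by
  refine Set.iUnion_congr fun s => ?_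
  rw [← received_ofSets code rounds Seed send output ω st x hw rounds s]
  rfl

end OfSets

section Comap

variable {p : ℕ} {X St Y X' St' Y' : Type}

/-- The protocol that runs `A` on translated inputs and statistics and translates its output. -/
def comap (A : MPCProtocol p X' St' Y') (f : X → X') (g : St → St') (o : Finset Y' → Finset Y) :
    MPCProtocol p X St Y where
  rounds := A.rounds
  Seed := A.Seed
  seedFintype := A.seedFintype
  seedNonempty := A.seedNonempty
  send ω st s x l d := A.send ω (g st) s (f x) l d
  output ω st s x l := o (A.output ω (g st) s (f x) l)

variable (A : MPCProtocol p X' St' Y') (f : X → X') (g : St → St') (o : Finset Y' → Finset Y)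
  (ω : A.Seed) (st : St) (x : Fin p → X)

theorem received_comap (r : ℕ) (s : Fin p) :
    (A.comap f g o).received ω st x r s = A.received ω (g st) (f ∘ x) r s := by
  induction r generalizing s with
  | zero => rfl
  | succ r ih =>
    simp only [received, ih]
    rfl

theorem load_comap : (A.comap f g o).load ω st x = A.load ω (g st) (f ∘ x) := by
  unfold load bitsReceived
  simp only [received_comap]
  rfl

theorem result_comap :
    (A.comap f g o).result ω st x =
      ⋃ s, (o (A.output ω (g st) s (f (x s)) (A.received ω (g st) (f ∘ x) A.rounds s)) : Set Y) := by
  refine Set.iUnion_congr fun s => ?_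
  change ((A.comap f g o).output ω st s (x s) ((A.comap f g o).received ω st x A.rounds s) :
    Set Y) = _
  rw [received_comap]
  rfl

end Comap

end MPCProtocol

/-! ### Concentration of hashing. -/

/-- The exponential moment bound for a weighted number of hits of independent uniform hash
values. -/
theorem sum_two_rpow_hits_le {I : Type*} [Fintype I] [DecidableEq I] {q : ℕ} (hq : 0 < q)
    (B : I → Finset (Fin q)) (w : I → ℝ) (hw0 : ∀ a, 0 ≤ w a) (hw1 : ∀ a, w a ≤ 1) {κ : ℝ}
    (hκ : ∑ a, w a * (B a).card ≤ κ * q) :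
    ∑ ω : I → Fin q, (2 : ℝ) ^ (∑ a, if ω a ∈ B a then w a else 0) ≤
      Real.exp κ * (q : ℝ) ^ Fintype.card I := by
  have hq' : (0 : ℝ) < q := by exact_mod_cast hq
  have h1 : ∀ ω : I → Fin q, (2 : ℝ) ^ (∑ a, if ω a ∈ B a then w a else 0) =
      ∏ a, (2 : ℝ) ^ (if ω a ∈ B a then w a else 0) := fun ω =>
    Real.rpow_sum_of_pos two_pos _ _
  simp only [h1]
  -- Independence of the hash values: the sum over all hash functions factors over the items.
  rw [← Fintype.piFinset_univ, Finset.sum_prod_piFinset (Finset.univ)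
    (fun a b => (2 : ℝ) ^ (if b ∈ B a then w a else 0))]
  have h2 : ∀ a, ∑ b : Fin q, (2 : ℝ) ^ (if b ∈ B a then w a else 0) ≤
      q * Real.exp (w a * (B a).card / q) := by
    intro a
    have h3 : ∀ b : Fin q, (2 : ℝ) ^ (if b ∈ B a then w a else 0) ≤
        1 + (if b ∈ B a then w a else 0) := by
      intro b
      split_ifs
      -- Bernoulli's inequality for exponents in `[0, 1]`: `2 ^ w ≤ 1 + w`.
      · have := rpow_one_add_le_one_add_mul_self (s := 1) (by norm_num) (hw0 a) (hw1 a)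
        norm_num at this
        linarith
      · simp
    calc _ ≤ ∑ b : Fin q, (1 + (if b ∈ B a then w a else 0)) := Finset.sum_le_sum fun b _ => h3 b
      _ = q * (w a * (B a).card / q + 1) := by
        rw [Finset.sum_add_distrib, ← Finset.sum_filter]
        simp
        field_simp
        ring
      _ ≤ _ := by
        gcongr
        exact Real.add_one_le_exp _
  calc _ ≤ ∏ a, (q * Real.exp (w a * (B a).card / q)) :=
        Finset.prod_le_prod (fun a _ => Finset.sum_nonneg fun b _ => by positivity)
          fun a _ => h2 a
    _ = (q : ℝ) ^ Fintype.card I * Real.exp (∑ a, w a * (B a).card / q) := by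
        rw [Finset.prod_mul_distrib, Real.exp_sum]
        simp
    _ ≤ _ := by
        rw [mul_comm]
        gcongr
        rw [← Finset.sum_div, div_le_iff₀ hq']
        exact hκ

/-- The elements of a finite set `F` are hashed through their items; if no item is shared by too
many elements, then rarely many elements hit their targets. -/
theorem ncard_many_hits_le {I T : Type*} [Fintype I] [DecidableEq I] {q : ℕ} (hq : 0 < q)
    (F : Finset T) (item : T → I) (B : I → Finset (Fin q)) {τ : ℝ} (hτ : 0 < τ)
    (hfib : ∀ a, ((F.filter fun t => item t = a).card : ℝ) ≤ τ) {κ : ℝ}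
    (hκ : ∑ t ∈ F, ((B (item t)).card : ℝ) ≤ κ * τ * q) (θ : ℝ) :
    (({ω : I → Fin q | θ * τ < ((F.filter fun t => ω (item t) ∈ B (item t)).card : ℝ)}.ncard
      : ℕ) : ℝ) ≤ Real.exp κ * (2 : ℝ) ^ (-θ) * (q : ℝ) ^ Fintype.card I := by
  classical
  -- All elements sharing an item hit or miss together; dividing the fibre sizes by `τ` gives
  -- weights in `[0, 1]`.
  set w : I → ℝ := fun a => (F.filter fun t => item t = a).card / τ with hw
  have hsum : ∀ f : I → ℝ, ∑ a, ((F.filter fun t => item t = a).card : ℝ) * f a =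
      ∑ t ∈ F, f (item t) := by
    intro f
    rw [← Finset.sum_fiberwise F item]
    refine Finset.sum_congr rfl fun a _ => ?_
    rw [Finset.sum_congr rfl (g := fun _ => f a)]
    · simp
    · intro t ht
      rw [(Finset.mem_filter.mp ht).2]
  have hX : ∀ ω : I → Fin q, (∑ a, if ω a ∈ B a then w a else 0) =
      ((F.filter fun t => ω (item t) ∈ B (item t)).card : ℝ) / τ := by
    intro ω
    rw [Finset.card_filter]
    push_cast
    rw [← hsum fun a => if ω a ∈ B a then (1 : ℝ) else 0, Finset.sum_div]
    refine Finset.sum_congr rfl fun a _ => ?_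
    split_ifs <;> simp [hw]
  have hmain := sum_two_rpow_hits_le hq B w (fun a => by positivity)
    (fun a => (div_le_one hτ).mpr (hfib a)) (κ := κ) (by
      have : ∑ a, w a * ((B a).card : ℝ) = (∑ t ∈ F, ((B (item t)).card : ℝ)) / τ := by
        rw [← hsum fun a => ((B a).card : ℝ), Finset.sum_div]
        exact Finset.sum_congr rfl fun a _ => by simp only [hw]; ring
      rw [this, div_le_iff₀ hτ]
      linarith)
  rw [Set.ncard_eq_toFinset_card']
  set G := {ω : I → Fin q |
    θ * τ < ((F.filter fun t => ω (item t) ∈ B (item t)).card : ℝ)}.toFinset with hG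
  -- Markov's inequality for the exponential moment.
  have h1 : (G.card : ℝ) * (2 : ℝ) ^ θ ≤
      ∑ ω : I → Fin q, (2 : ℝ) ^ (∑ a, if ω a ∈ B a then w a else 0) := by
    calc (G.card : ℝ) * (2 : ℝ) ^ θ = ∑ ω ∈ G, (2 : ℝ) ^ θ := by simp
      _ ≤ ∑ ω ∈ G, (2 : ℝ) ^ (∑ a, if ω a ∈ B a then w a else 0) := by
        refine Finset.sum_le_sum fun ω hω => ?_
        refine Real.rpow_le_rpow_of_exponent_le one_le_two ?_
        rw [hX, le_div_iff₀ hτ]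
        simp only [hG, Set.mem_toFinset, Set.mem_ofPred_eq] at hω
        exact hω.le
      _ ≤ _ := Finset.sum_le_sum_of_subset_of_nonneg (Finset.subset_univ _)
        fun _ _ _ => by positivity
  have h2 : (0 : ℝ) < 2 ^ θ := by positivity
  rw [Real.rpow_neg two_pos.le]
  have := h1.trans hmain
  rw [← le_div_iff₀ h2] at this
  calc _ ≤ _ := this
    _ = _ := by ring

/-! ### Dedicated coordinates for heavy values. -/

/-- A slotting assigns pairwise distinct elements of `γ` to the copies `0, …, P v - 1` of all `v`. -/
def IsSlotting {β γ : Type*} (P : β → ℕ) (f : β → ℕ → γ) : Prop :=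
  ∀ v i v' i', i < P v → i' < P v' → f v i = f v' i' → v = v' ∧ i = i'

theorem exists_isSlotting {β : Type*} [Fintype β] {q : ℕ} [NeZero q] (P : β → ℕ)
    (h : ∑ v, P v ≤ q) : ∃ f : β → ℕ → Fin q, IsSlotting P f := by
  have hc : Fintype.card (Σ v, Fin (P v)) ≤ Fintype.card (Fin q) := by simpa using h
  obtain ⟨e⟩ := Embedding.nonempty_of_card_le hc
  refine ⟨fun v i => if hi : i < P v then e ⟨v, i, hi⟩ else 0, ?_⟩
  intro v i v' i' hi hi' heq
  simp only [hi, hi', dif_pos] at heq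
  have := e.injective heq
  rw [Sigma.mk.injEq] at this
  obtain ⟨rfl, h2⟩ := this
  simpa using h2

open Classical in
/-- A slotting with values in `Fin q`, provided there is one. -/
noncomputable def slot {β : Type*} {q : ℕ} [NeZero q] (P : β → ℕ) : β → ℕ → Fin q :=
  if h : ∃ f : β → ℕ → Fin q, IsSlotting P f then h.choose else fun _ _ => 0

theorem isSlotting_slot {β : Type*} [Fintype β] {q : ℕ} [NeZero q] {P : β → ℕ}
    (h : ∑ v, P v ≤ q) : IsSlotting P (slot P : β → ℕ → Fin q) := by
  have := exists_isSlotting P h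
  unfold slot
  rw [dif_pos this]
  exact this.choose_spec

/-!
The zigzag query of length `j` has relations `E 0, …, E j` and `O 0, …, O (j - 1)`; its answers are
the sequences of tuples `y i ∈ E i` such that `((y i).2, (y (i + 1)).1) ∈ O i`. The servers form a
grid with coordinates in `Fin q`, one for each relation `E i`, which is split by a hash value
of its second attribute (of its first one for `i = j`). The values that occur too often are
spread over several dedicated coordinates.
-/

/-! ### The zigzag protocol: placement of tuples and messages. -/

namespace Zigzag

/-- The records `(0, i, t)` and `(1, i, t)` stand for `t ∈ E i` and `t ∈ O i`. A record `(2, i, t)`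
tells the server that `t ∈ E i` joins with a tuple of `O (i - 1)`. -/
abbrev Record (j n : ℕ) : Type := Fin 3 × Fin (j + 1) × (Fin n × Fin n)

/-- An attribute of one of the relations `E i`: the second one for `true`, the first one for
`false`. -/
abbrev Attr (j : ℕ) : Type := Bool × Fin (j + 1)

/-- The hash functions for values and for tuples, one for each attribute. -/
abbrev Hash (j n q : ℕ) : Type := Attr j × (Fin n ⊕ Fin n × Fin n) → Fin q

/-- The number of dedicated coordinates of every value; it is zero for the light values. -/
abbrev Shares (j n : ℕ) : Type := Attr j → Fin n → ℕ

/-- The coordinates of a server in the grid. -/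
abbrev Coord (j q : ℕ) : Type := Fin (j + 1) → Fin q

/-- The value of an attribute of a tuple. -/
def key {n : ℕ} (b : Bool) (t : Fin n × Fin n) : Fin n := if b then t.2 else t.1

variable {j n q p : ℕ} [NeZero q]

/-- The coordinate to which a tuple is sent when its relation is split by the attribute `c`. -/
noncomputable def place (P : Shares j n) (ω : Hash j n q) (c : Attr j) (t : Fin n × Fin n) :
    Fin q :=
  if P c (key c.1 t) = 0 then ω (c, .inl (key c.1 t))
  else slot (P c) (key c.1 t) ((ω (c, .inr t)).val % P c (key c.1 t))

/-- The coordinate `ρ` is dedicated to the value `v` of the attribute `c`. -/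
def Hosts (P : Shares j n) (c : Attr j) (v : Fin n) (ρ : Fin q) : Prop :=
  ∃ i < P c v, slot (P c) v i = ρ

/-- Tuples with the value `v` in the attribute `c` may be sent to the coordinate `ρ`. -/
def Covers (P : Shares j n) (ω : Hash j n q) (c : Attr j) (v : Fin n) (ρ : Fin q) : Prop :=
  Hosts P c v ρ ∨ P c v = 0 ∧ ω (c, .inl v) = ρ

/-- The records for the join of `O (l - 1)` and `E l` at the heavy values of the first attribute
of `O (l - 1)`, which takes place at the coordinates `σ (l - 1)` and `σ l`. -/
def JoinRecord (P : Shares j n) (ω : Hash j n q) (σ : Coord j q) (l : Fin (j + 1))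
    (a : Record j n) : Prop :=
  (a.1 = 0 ∧ a.2.1 = l ∧ place P ω (false, l) a.2.2 = σ l) ∨
  (a.1 = 1 ∧ a.2.1 ≠ Fin.last j ∧ a.2.1 + 1 = l ∧ Hosts P (true, a.2.1) a.2.2.1 (σ a.2.1) ∧
    Covers P ω (false, l) a.2.2.2 (σ l))

/-- The input records that the server with coordinates `σ` receives in the first of two rounds. -/
def FirstRecord (P : Shares j n) (ω : Hash j n q) (σ : Coord j q) (a : Record j n) : Prop :=
  ∃ l, l ≠ Fin.last j ∧ JoinRecord P ω σ l a

/-- The input records that the server with coordinates `σ` receives in the last round. -/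
def LastRecord (P : Shares j n) (ω : Hash j n q) (σ : Coord j q) (a : Record j n) : Prop :=
  JoinRecord P ω σ (Fin.last j) a ∨
  (a.1 = 0 ∧ a.2.1 ≠ Fin.last j ∧ place P ω (true, a.2.1) a.2.2 = σ a.2.1) ∨
  (a.1 = 1 ∧ P (true, a.2.1) a.2.2.1 = 0 ∧ ω ((true, a.2.1), .inl a.2.2.1) = σ a.2.1)

/-- The records about joins that server `s`, which has received `R`, sends to the server with
coordinates `σ` in the last round. -/
def SentMark (sec : Coord j q ↪ Fin p) (P : Shares j n) (ω : Hash j n q) (s : Fin p)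
    (R : Finset (Record j n)) (σ : Coord j q) (a : Record j n) : Prop :=
  a.1 = 2 ∧ a.2.1 ≠ Fin.last j ∧ place P ω (true, a.2.1) a.2.2 = σ a.2.1 ∧
  s = sec (update σ a.2.1 (place P ω (false, a.2.1) a.2.2)) ∧
  ((0, a.2) : Record j n) ∈ R ∧
  ∃ v i, i ≠ Fin.last j ∧ i + 1 = a.2.1 ∧ ((1, i, (v, a.2.2.1)) : Record j n) ∈ R

/-- The records about joins of the input `D` that the server with coordinates `σ` receives. -/
def Mark (D : Finset (Record j n)) (P : Shares j n) (ω : Hash j n q) (σ : Coord j q)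
    (a : Record j n) : Prop :=
  a.1 = 2 ∧ a.2.1 ≠ Fin.last j ∧ place P ω (true, a.2.1) a.2.2 = σ a.2.1 ∧
  ((0, a.2) : Record j n) ∈ D ∧
  ∃ v i, i ≠ Fin.last j ∧ i + 1 = a.2.1 ∧ ((1, i, (v, a.2.2.1)) : Record j n) ∈ D ∧
    Hosts P (true, i) v (σ i)

/-- The answers that the server with coordinates `σ` finds if it received `R` in the last round. -/
def IsAnswer (P : Shares j n) (σ : Coord j q) (R : Finset (Record j n))
    (y : Fin (j + 1) → Fin n × Fin n) : Prop :=
  (∀ i, ((0, i, y i) : Record j n) ∈ R) ∧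
  ∀ i, i ≠ Fin.last j → ((1, i, ((y i).2, (y (i + 1)).1)) : Record j n) ∈ R ∨
    (Hosts P (true, i) (y i).2 (σ i) ∧ ((2, i + 1, y (i + 1)) : Record j n) ∈ R)

/-- The answers to the zigzag query on the input `D`. -/
def answers (D : Finset (Record j n)) : Set (Fin (j + 1) → Fin n × Fin n) :=
  {y | (∀ i, ((0, i, y i) : Record j n) ∈ D) ∧
    ∀ i, i ≠ Fin.last j → ((1, i, ((y i).2, (y (i + 1)).1)) : Record j n) ∈ D}

open Classical in
/-- The records that the server with coordinates `σ` receives in the first of two rounds. -/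
noncomputable def firstReceived (D : Finset (Record j n)) (P : Shares j n) (ω : Hash j n q)
    (σ : Coord j q) : Finset (Record j n) :=
  D.filter (FirstRecord P ω σ)

open Classical in
/-- The records that the server with coordinates `σ` receives in the last round. -/
noncomputable def lastReceived (D : Finset (Record j n)) (P : Shares j n) (ω : Hash j n q)
    (σ : Coord j q) : Finset (Record j n) :=
  D.filter (LastRecord P ω σ) ∪ Finset.univ.filter (Mark D P ω σ)

open Classical in
/-- The sets of records sent by a server. -/
noncomputable def send (sec : Coord j q ↪ Fin p) (ω : Hash j n q) (P : Shares j n) (s : Fin p)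
    (x : Finset (Record j n)) (l : List (Finset (Record j n))) (d : Fin p) :
    Finset (Record j n) :=
  if l.length + 1 = min j 2 then
    x.filter (LastRecord P ω (invFun sec d)) ∪
      Finset.univ.filter (SentMark sec P ω s (l.headD ∅) (invFun sec d))
  else x.filter (FirstRecord P ω (invFun sec d))

open Classical in
/-- The answers found by a server. -/
noncomputable def output (sec : Coord j q ↪ Fin p) (_ω : Hash j n q) (P : Shares j n) (s : Fin p)
    (_x : Finset (Record j n)) (l : List (Finset (Record j n))) :
    Finset (Fin (j + 1) → Fin n × Fin n) :=
  Finset.univ.filter (IsAnswer P (invFun sec s) (l.getLastD ∅))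

/-! ### Soundness and completeness of the answers found at a grid point. -/

theorem place_of_eq_zero {P : Shares j n} {ω : Hash j n q} {c : Attr j} {t : Fin n × Fin n}
    (h : P c (key c.1 t) = 0) : place P ω c t = ω (c, .inl (key c.1 t)) := if_pos h

theorem hosts_place {P : Shares j n} {ω : Hash j n q} {c : Attr j} {t : Fin n × Fin n}
    (h : P c (key c.1 t) ≠ 0) : Hosts P c (key c.1 t) (place P ω c t) := by
  unfold place
  rw [if_neg h]
  exact ⟨_, Nat.mod_lt _ (Nat.pos_of_ne_zero h), rfl⟩

theorem covers_place (P : Shares j n) (ω : Hash j n q) (c : Attr j) (t : Fin n × Fin n) :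
    Covers P ω c (key c.1 t) (place P ω c t) := by
  by_cases h : P c (key c.1 t) = 0
  · exact Or.inr ⟨h, (place_of_eq_zero h).symm⟩
  · exact Or.inl (hosts_place h)

theorem Hosts.unique {P : Shares j n} {c : Attr j} (hP : ∑ v, P c v ≤ q) {v v' : Fin n}
    {ρ : Fin q} (h : Hosts P c v ρ) (h' : Hosts P c v' ρ) : v = v' := by
  obtain ⟨i, hi, rfl⟩ := h
  obtain ⟨i', hi', h⟩ := h'
  exact (isSlotting_slot hP _ _ _ _ hi hi' h.symm).1

/-- A mark does not name the value through which its tuple joins. That value is hosted by `σ i`, and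
`Hosts.unique` identifies it with `(y i).2`. -/
theorem isAnswer_lastReceived {D : Finset (Record j n)} {P : Shares j n} {ω : Hash j n q}
    (hP : ∀ c, ∑ v, P c v ≤ q) (hD : ∀ i t, ((2, i, t) : Record j n) ∉ D) {σ : Coord j q}
    {y : Fin (j + 1) → Fin n × Fin n} (h : IsAnswer P σ (lastReceived D P ω σ) y) :
    y ∈ answers D := by
  have hin : ∀ a : Record j n, a.1 ≠ 2 → a ∈ lastReceived D P ω σ → a ∈ D := by
    intro a ha h
    simp only [lastReceived, Finset.mem_union, Finset.mem_filter, Finset.mem_univ, true_and] at h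
    rcases h with h | h
    · exact h.1
    · exact absurd h.1 ha
  refine ⟨fun i => hin _ (by simp) (h.1 i), fun i hi => ?_⟩
  rcases h.2 i hi with h' | ⟨h1, h2⟩
  · exact hin _ (by simp) h'
  · simp only [lastReceived, Finset.mem_union, Finset.mem_filter, Finset.mem_univ, true_and,
      hD, false_and, false_or] at h2
    obtain ⟨-, -, -, -, v, i', hi', h3, h4, h5⟩ := h2
    obtain rfl : i' = i := add_right_cancel h3
    rwa [h1.unique (hP _) h5]

theorem exists_isAnswer_lastReceived {D : Finset (Record j n)} (P : Shares j n) (ω : Hash j n q)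
    {y : Fin (j + 1) → Fin n × Fin n} (hy : y ∈ answers D) :
    ∃ σ, IsAnswer P σ (lastReceived D P ω σ) y := by
  -- The server that finds `y` has as coordinates the places of the tuples `y i`, taken by the
  -- second attribute except for the last one.
  set σ : Coord j q := fun i =>
    if i = Fin.last j then place P ω (false, i) (y i) else place P ω (true, i) (y i) with hσ
  have hlast : σ (Fin.last j) = place P ω (false, Fin.last j) (y (Fin.last j)) := if_pos rfl
  have hne : ∀ i, i ≠ Fin.last j → σ i = place P ω (true, i) (y i) := fun i hi => if_neg hi
  have hmem : ∀ a, a ∈ lastReceived D P ω σ ↔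
      (a ∈ D ∧ LastRecord P ω σ a) ∨ Mark D P ω σ a := by
    intro a
    simp [lastReceived]
  refine ⟨σ, fun i => (hmem _).mpr (Or.inl ⟨hy.1 i, ?_⟩), fun i hi => ?_⟩
  · by_cases hi : i = Fin.last j
    · subst hi
      exact Or.inl (Or.inl ⟨rfl, rfl, hlast.symm⟩)
    · exact Or.inr (Or.inl ⟨rfl, hi, (hne i hi).symm⟩)
  · have hO := hy.2 i hi
    by_cases h0 : P (true, i) (y i).2 = 0
    · refine Or.inl ((hmem _).mpr (Or.inl ⟨hO, Or.inr (Or.inr ⟨rfl, h0, ?_⟩)⟩))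
      rw [hne i hi]
      exact (place_of_eq_zero (c := (true, i)) (t := y i) h0).symm
    · have hh : Hosts P (true, i) (y i).2 (σ i) := by
        rw [hne i hi]
        exact hosts_place (c := (true, i)) (t := y i) h0
      -- Both cases concern a heavy link value. The last `E` is split by its first attribute, so the
      -- tuple of `O i` arrives directly; otherwise a mark replaces it.
      by_cases hl : i + 1 = Fin.last j
      · refine Or.inl ((hmem _).mpr (Or.inl ⟨hO, Or.inl (Or.inr ⟨rfl, hi, hl, hh, ?_⟩)⟩))
        rw [hlast, hl]
        exact covers_place P ω (false, Fin.last j) _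
      · exact Or.inr ⟨hh, (hmem _).mpr (Or.inr ⟨rfl, hl, (hne _ hl).symm, hy.1 _, _, i, hi, rfl,
          hO, hh⟩)⟩

/-- The zigzag protocol. -/
noncomputable def protocol {w : ℕ} (code : Record j n ↪ (Fin w → Bool))
    (sec : Coord j q ↪ Fin p) :
    MPCProtocol p (Finset (Record j n)) (Shares j n) (Fin (j + 1) → Fin n × Fin n) :=
  MPCProtocol.ofSets code (min j 2) (Hash j n q) (send sec) (output sec)

/-! ### The execution of the protocol on a distributed input. -/

section Execution

open MPCProtocol

variable {sec : Coord j q ↪ Fin p} {ω : Hash j n q} {P : Shares j n} {D : Finset (Record j n)}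
  {x : Fin p → Finset (Record j n)} {owner : Record j n → Fin p}
  (hx : ∀ a s, a ∈ x s ↔ a ∈ D ∧ owner a = s)

theorem length_setHistory (r : ℕ) (s : Fin p) :
    (setHistory (send sec) ω P x r s).length = r := by
  induction r with
  | zero => rfl
  | succ r ih => simp [setHistory, ih]

include hx in
theorem exists_mem_send_of_ne {r : ℕ} (hr : r + 1 ≠ min j 2) (d : Fin p) (a : Record j n) :
    (∃ s, a ∈ send sec ω P s (x s) (setHistory (send sec) ω P x r s) d) ↔
      a ∈ firstReceived D P ω (invFun sec d) := by
  simp only [send, length_setHistory, hr, if_false, firstReceived, Finset.mem_filter, hx]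
  exact ⟨fun ⟨s, ⟨h1, h2⟩, h3⟩ => ⟨h1, h3⟩, fun ⟨h1, h2⟩ => ⟨_, ⟨h1, rfl⟩, h2⟩⟩

-- `Mark` describes the marks through the whole input, `SentMark` through what a sender holds. They
-- agree because the sender shares all coordinates with `σ` but the one of the marked tuple, so it
-- sees the same hosted value at `σ i`.
include hx in
theorem exists_sentMark_iff (hj : 0 < j) {r : ℕ} (hr : r + 1 = min j 2) (σ : Coord j q)
    (a : Record j n) :
    (∃ s, SentMark sec P ω s ((setHistory (send sec) ω P x r s).headD ∅) σ a) ↔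
      Mark D P ω σ a := by
  have hsucc : ∀ i : Fin (j + 1), i ≠ Fin.last j → (i + 1).val = i.val + 1 := fun i hi =>
    Fin.val_add_one_of_lt (Fin.lt_last_iff_ne_last.mpr hi)
  have hval : ∀ i : Fin (j + 1), i ≠ Fin.last j → i.val < j := fun i hi =>
    Fin.val_lt_last hi
  -- With one round there are no marks at all: a marked relation has a predecessor and is not the
  -- last.
  by_cases hj1 : j = 1
  · constructor
    · rintro ⟨s, -, h2, -, -, -, v, i, h3, h4, -⟩
      have := hval _ h2
      rw [← h4, hsucc i h3] at this
      omega
    · rintro ⟨-, h2, -, -, v, i, h3, h4, -⟩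
      have := hval _ h2
      rw [← h4, hsucc i h3] at this
      omega
  have hr1 : r = 1 := by omega
  subst hr1
  have hH : ∀ s, (setHistory (send sec) ω P x 1 s).headD ∅ =
      firstReceived D P ω (invFun sec s) := by
    intro s
    ext a
    rw [← exists_mem_send_of_ne hx (r := 0) (by omega) s]
    simp [setHistory]
  simp only [hH]
  have hinv : ∀ τ, invFun sec (sec τ) = τ := leftInverse_invFun sec.injective
  constructor
  · rintro ⟨s, h1, h2, h3, h4, h5, v, i, h6, h7, h8⟩
    subst h4
    rw [hinv] at h5 h8
    simp only [firstReceived, Finset.mem_filter] at h5 h8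
    refine ⟨h1, h2, h3, h5.1, v, i, h6, h7, h8.1, ?_⟩
    obtain ⟨l, -, h9⟩ := h8.2
    rcases h9 with h9 | ⟨-, -, -, h9, -⟩
    · exact absurd h9.1 (by simp)
    -- The `update` at coordinate `i + 1` leaves coordinate `i` alone.
    · have hne : i ≠ a.2.1 := by
        intro h
        have := hsucc i h6
        rw [h7, ← h] at this
        omega
      simpa [hne] using h9
  · rintro ⟨h1, h2, h3, h4, v, i, h5, h6, h7, h8⟩
    have hne : i ≠ a.2.1 := by
      intro h
      have := hsucc i h5
      rw [h6, ← h] at this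
      omega
    refine ⟨_, h1, h2, h3, rfl, ?_, v, i, h5, h6, ?_⟩
    · rw [hinv]
      simp only [firstReceived, Finset.mem_filter]
      exact ⟨h4, a.2.1, h2, Or.inl ⟨rfl, rfl, by simp⟩⟩
    · rw [hinv]
      simp only [firstReceived, Finset.mem_filter]
      refine ⟨h7, a.2.1, h2, Or.inr ⟨rfl, h5, h6, by simpa [hne] using h8, ?_⟩⟩
      simpa [key] using covers_place P ω (false, a.2.1) a.2.2

include hx in
theorem exists_mem_send_of_eq (hj : 0 < j) {r : ℕ} (hr : r + 1 = min j 2) (d : Fin p)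
    (a : Record j n) :
    (∃ s, a ∈ send sec ω P s (x s) (setHistory (send sec) ω P x r s) d) ↔
      a ∈ lastReceived D P ω (invFun sec d) := by
  simp only [lastReceived, Finset.mem_union, Finset.mem_filter, Finset.mem_univ, true_and,
    ← exists_sentMark_iff (sec := sec) hx hj hr, send, length_setHistory, hr,
    if_true, hx, exists_or]
  refine or_congr ?_ Iff.rfl
  exact ⟨fun ⟨s, ⟨h1, h2⟩, h3⟩ => ⟨h1, h3⟩, fun ⟨h1, h2⟩ => ⟨_, ⟨h1, rfl⟩, h2⟩⟩

include hx in
theorem result_protocol {w : ℕ} (hw : 0 < w) (code : Record j n ↪ (Fin w → Bool)) (hj : 0 < j)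
    (hP : ∀ c, ∑ v, P c v ≤ q) (hD : ∀ i t, ((2, i, t) : Record j n) ∉ D) :
    (protocol code sec).result ω P x = answers D := by
  have hlast : ∀ s, (setHistory (send sec) ω P x (min j 2) s).getLastD ∅ =
      lastReceived D P ω (invFun sec s) := by
    intro s
    obtain ⟨r, hr⟩ : ∃ r, r + 1 = min j 2 := ⟨min j 2 - 1, by omega⟩
    ext a
    rw [← exists_mem_send_of_eq hx hj hr s, ← hr]
    simp [setHistory]
  unfold protocol
  rw [result_ofSets _ _ _ _ _ _ _ _ hw]
  ext y
  simp only [output, hlast, Set.mem_iUnion, Finset.coe_filter, Finset.mem_univ, true_and,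
    Set.mem_ofPred_eq]
  constructor
  · rintro ⟨s, h⟩
    exact isAnswer_lastReceived hP hD h
  · intro h
    obtain ⟨σ, hσ⟩ := exists_isAnswer_lastReceived P ω h
    refine ⟨sec σ, ?_⟩
    rwa [leftInverse_invFun sec.injective]

-- Nothing is received twice: an input record has one owner, and the coordinates in `SentMark`
-- determine the sender of a mark.
include hx in
theorem sum_card_send (hj : 0 < j) (hD : ∀ i t, ((2, i, t) : Record j n) ∉ D) {r : ℕ} (d : Fin p) :
    ∑ s, (send sec ω P s (x s) (setHistory (send sec) ω P x r s) d).card =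
      (if r + 1 = min j 2 then lastReceived D P ω (invFun sec d)
        else firstReceived D P ω (invFun sec d)).card := by
  classical
  rw [← Finset.card_biUnion]
  · congr 1
    ext a
    rw [Finset.mem_biUnion]
    simp only [Finset.mem_univ, true_and]
    split_ifs with hr
    · exact exists_mem_send_of_eq hx hj hr d a
    · exact exists_mem_send_of_ne hx hr d a
  · intro s _ s' _ hss
    refine Finset.disjoint_left.mpr ?_
    intro a ha ha'
    apply hss
    have h2 : ∀ a ∈ D, a.1 ≠ 2 := by
      rintro ⟨b, i, t⟩ h rfl
      exact hD i t h
    simp only [send, length_setHistory] at ha ha'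
    split_ifs at ha ha' with hr
    · simp only [Finset.mem_union, Finset.mem_filter, hx, Finset.mem_univ, true_and] at ha ha'
      rcases ha with ha | ha <;> rcases ha' with ha' | ha'
      · rw [← ha.1.2, ← ha'.1.2]
      · exact absurd ha'.1 (h2 _ ha.1.1)
      · exact absurd ha.1 (h2 _ ha'.1.1)
      · rw [ha.2.2.2.1, ha'.2.2.2.1]
    · simp only [Finset.mem_filter, hx] at ha ha'
      rw [← ha.1.2, ← ha'.1.2]

include hx in
theorem load_protocol_le {w : ℕ} (hw : 0 < w) (code : Record j n ↪ (Fin w → Bool)) (hj : 0 < j)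
    (hD : ∀ i t, ((2, i, t) : Record j n) ∉ D) {N : ℝ} (hN : 0 ≤ N)
    (h1 : ∀ σ, ((firstReceived D P ω σ).card : ℝ) ≤ N)
    (h2 : ∀ σ, ((lastReceived D P ω σ).card : ℝ) ≤ N) :
    ((protocol code sec).load ω P x : ℝ) ≤ N * w := by
  have hfl : ((protocol code sec).load ω P x) ≤ ⌊N * w⌋₊ := by
    unfold load
    refine Finset.sup_le fun r _ => Finset.sup_le fun d _ => Nat.le_floor ?_
    unfold protocol
    rw [bitsReceived_ofSets _ _ _ _ _ _ _ _ hw, sum_card_send hx hj hD]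
    push_cast
    gcongr
    split_ifs
    · exact h2 _
    · exact h1 _
  exact (Nat.cast_le.mpr hfl).trans (Nat.floor_le (by positivity))

end Execution

end Zigzag

/-! ### Load analysis for random hash functions. -/

theorem card_filter_mod_eq_le (q P i : ℕ) :
    (Finset.univ.filter fun b : Fin q => b.val % P = i).card ≤ q / P + 1 := by
  rw [← Finset.card_range (q / P + 1)]
  refine Finset.card_le_card_of_injOn (fun b => b.val / P) (fun b _ => ?_) ?_
  · simp only [Finset.coe_range, Set.mem_Iio]
    exact Nat.lt_succ_of_le (Nat.div_le_div_right b.2.le)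
  · intro b hb b' hb' h
    simp only [Finset.coe_filter, Finset.mem_univ, true_and, Set.mem_ofPred_eq] at hb hb' h
    apply Fin.ext
    rw [← Nat.div_add_mod b.val P, ← Nat.div_add_mod b'.val P, hb, hb', h]

namespace Zigzag

variable {j n q : ℕ}

/-- The tuples in the records with a given label. -/
def rel (D : Finset (Record j n)) (b : Fin 3) (i : Fin (j + 1)) : Finset (Fin n × Fin n) :=
  Finset.univ.filter fun t => ((b, i, t) : Record j n) ∈ D

theorem card_le_of_rel_le {R : Finset (Record j n)} {N : ℝ}
    (h : ∀ b i, ((rel R b i).card : ℝ) ≤ N) : (R.card : ℝ) ≤ 3 * (j + 1) * N := by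
  have h1 : R.card = ∑ b, ∑ i, (rel R b i).card := by
    have h2 : R.card = ∑ a, if a ∈ R then 1 else 0 := by simp
    simp only [h2, rel, Finset.card_filter, Fintype.sum_prod_type]
  rw [h1]
  push_cast
  calc ∑ b : Fin 3, ∑ i : Fin (j + 1), ((rel R b i).card : ℝ)
      ≤ ∑ _b : Fin 3, ∑ _i : Fin (j + 1), N :=
        Finset.sum_le_sum fun b _ => Finset.sum_le_sum fun i _ => h b i
    _ = _ := by simp; ring

/-- The shares suit an input with relations of size at most `m`: there are at most `q` of them for
each attribute, and every value has a share for each `3 * m / q` tuples. -/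
structure Admissible (q m : ℕ) (D : Finset (Record j n)) (P : Shares j n) : Prop where
  sum_le : ∀ c, ∑ v, P c v ≤ q
  card_le : ∀ b i, (rel D b i).card ≤ m
  degree_le : ∀ c v, q * ((rel D 0 c.2).filter fun t => key c.1 t = v).card ≤
    3 * m * max 1 (P c v)
  degree_link_le : ∀ i v, P (true, i) v = 0 →
    q * ((rel D 1 i).filter fun t => t.1 = v).card ≤ 3 * m

variable [NeZero q] {m : ℕ} {D : Finset (Record j n)} {P : Shares j n}

open Classical in
/-- The tuples of `E i` that are placed at a coordinate. -/
noncomputable def placedAt (D : Finset (Record j n)) (P : Shares j n) (ω : Hash j n q)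
    (c : Attr j) (ρ : Fin q) : Finset (Fin n × Fin n) :=
  (rel D 0 c.2).filter fun t => place P ω c t = ρ

open Classical in
/-- The tuples of `O i` whose first attribute is light and hashed to a coordinate. -/
noncomputable def lightAt (D : Finset (Record j n)) (P : Shares j n) (ω : Hash j n q)
    (i : Fin (j + 1)) (ρ : Fin q) : Finset (Fin n × Fin n) :=
  (rel D 1 i).filter fun t => P (true, i) t.1 = 0 ∧ ω ((true, i), .inl t.1) = ρ

open Classical in
/-- The tuples of `O i` whose first attribute is hosted by `ρ` and whose second attribute is light
and hashed to `ρ'`. -/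
noncomputable def joinAt (D : Finset (Record j n)) (P : Shares j n) (ω : Hash j n q)
    (i : Fin (j + 1)) (ρ ρ' : Fin q) : Finset (Fin n × Fin n) :=
  (rel D 1 i).filter fun t => (Hosts P (true, i) t.1 ρ ∧ P (false, i + 1) t.2 = 0) ∧
    ω ((false, i + 1), .inl t.2) = ρ'

theorem threshold_mul : (3 * m / q : ℝ) * q = 3 * m :=
  div_mul_cancel₀ _ (by exact_mod_cast NeZero.ne q)

theorem threshold_ge_one (hqm : q ≤ m) : (1 : ℝ) ≤ 3 * m / q := by
  have hq : (0 : ℝ) < q := by exact_mod_cast NeZero.pos q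
  rw [le_div_iff₀ hq]
  have : (q : ℝ) ≤ m := by exact_mod_cast hqm
  linarith

-- Only one heavy value can be hosted by `ρ`, and each of its tuples reaches `ρ` with probability
-- about one over its share. As the share is proportional to the degree, the expected number of its
-- tuples at `ρ` is `O(m / q)`.
open Classical in
theorem sum_card_target_le (hA : Admissible q m D P) (c : Attr j) (ρ : Fin q) :
    ∑ t ∈ (rel D 0 c.2).filter (fun t => P c (key c.1 t) ≠ 0),
      (Finset.univ.filter fun b : Fin q =>
        slot (P c) (key c.1 t) (b.val % P c (key c.1 t)) = ρ).card ≤ 6 * m := by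
  by_cases hv : ∃ v, Hosts P c v ρ
  · obtain ⟨v, hv⟩ := hv
    have hv' := hv
    obtain ⟨i, hi, hρ⟩ := hv'
    have hPq : P c v ≤ q :=
      (Finset.single_le_sum (f := P c) (fun _ _ => Nat.zero_le _) (Finset.mem_univ v)).trans
        (hA.sum_le c)
    have hslot := isSlotting_slot (q := q) (hA.sum_le c)
    have hB : ∀ t ∈ (rel D 0 c.2).filter (fun t => P c (key c.1 t) ≠ 0),
        (Finset.univ.filter fun b : Fin q =>
          slot (P c) (key c.1 t) (b.val % P c (key c.1 t)) = ρ).card ≤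
        if key c.1 t = v then q / P c v + 1 else 0 := by
      intro t ht
      have ht0 := Nat.pos_of_ne_zero (Finset.mem_filter.mp ht).2
      split_ifs with hk
      · refine le_trans (Finset.card_le_card fun b hb => ?_)
          (card_filter_mod_eq_le q (P c v) i)
        simp only [Finset.mem_filter, Finset.mem_univ, true_and] at hb ⊢
        rw [hk] at hb
        exact (hslot _ _ _ _ (Nat.mod_lt _ (by omega)) hi (hb.trans hρ.symm)).2
      · rw [Nat.le_zero, Finset.card_eq_zero, Finset.filter_eq_empty_iff]
        intro b _ hb
        exact hk (hslot _ _ _ _ (Nat.mod_lt _ ht0) hi (hb.trans hρ.symm)).1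
    refine (Finset.sum_le_sum hB).trans ?_
    rw [← Finset.sum_filter, Finset.sum_const, smul_eq_mul]
    have hd : (Finset.filter (fun t => key c.1 t = v)
        ((rel D 0 c.2).filter fun t => P c (key c.1 t) ≠ 0)).card ≤
        ((rel D 0 c.2).filter fun t => key c.1 t = v).card :=
      Finset.card_le_card (Finset.filter_subset_filter _ (Finset.filter_subset _ _))
    refine (Nat.mul_le_mul_right _ hd).trans ?_
    have h1 := hA.degree_le c v
    -- `v` has a positive share, so `h1` becomes `q * d ≤ 3 * m * P c v`; rounding in the residue
    -- classes costs a factor 2, since `P c v ≤ q`.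
    rw [max_eq_right (by omega)] at h1
    set d := ((rel D 0 c.2).filter fun t => key c.1 t = v).card
    have h2 : (q / P c v + 1) * P c v ≤ 2 * q := by
      have := Nat.div_mul_le_self q (P c v)
      nlinarith
    refine Nat.le_of_mul_le_mul_right (c := P c v) ?_ (by omega)
    calc d * (q / P c v + 1) * P c v = d * ((q / P c v + 1) * P c v) := by ring
      _ ≤ d * (2 * q) := Nat.mul_le_mul_left _ h2
      _ = 2 * (q * d) := by ring
      _ ≤ 2 * (3 * m * P c v) := Nat.mul_le_mul_left _ h1
      _ = 6 * m * P c v := by ring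
  · rw [Finset.sum_eq_zero]
    · exact Nat.zero_le _
    · intro t ht
      have ht0 := Nat.pos_of_ne_zero (Finset.mem_filter.mp ht).2
      rw [Finset.card_eq_zero, Finset.filter_eq_empty_iff]
      intro b _ hb
      exact hv ⟨_, _, Nat.mod_lt _ ht0, hb⟩

theorem ncard_placedAt_le (hA : Admissible q m D P) (hqm : q ≤ m) (c : Attr j) (ρ : Fin q)
    (θ : ℝ) :
    (({ω : Hash j n q | θ * (3 * m / q) < ((placedAt D P ω c ρ).card : ℝ)}.ncard : ℕ) : ℝ) ≤
      Real.exp 3 * (2 : ℝ) ^ (-θ) *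
        (q : ℝ) ^ Fintype.card (Attr j × (Fin n ⊕ Fin n × Fin n)) := by
  classical
  have hq : (0 : ℝ) < q := by exact_mod_cast NeZero.pos q
  have hτ := threshold_ge_one hqm
  -- Light tuples are hashed by value, in fibres bounded through `degree_le`; heavy ones are hashed
  -- individually, in fibres of size at most one.
  set item : Fin n × Fin n → Attr j × (Fin n ⊕ Fin n × Fin n) := fun t =>
    if P c (key c.1 t) = 0 then (c, .inl (key c.1 t)) else (c, .inr t) with hitem
  set B : Attr j × (Fin n ⊕ Fin n × Fin n) → Finset (Fin q) := fun a =>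
    Sum.elim (fun _ => {ρ}) (fun t => Finset.univ.filter fun b : Fin q =>
      slot (P c) (key c.1 t) (b.val % P c (key c.1 t)) = ρ) a.2 with hB
  have hmem : ∀ (ω : Hash j n q) t, ω (item t) ∈ B (item t) ↔ place P ω c t = ρ := by
    intro ω t
    simp only [hitem, hB, place]
    split_ifs <;> simp
  have := ncard_many_hits_le (NeZero.pos q) (rel D 0 c.2) item B (τ := 3 * m / q) (by linarith)
    (κ := 3) ?_ ?_ θ
  · simp only [hmem] at this
    convert this using 7
    unfold placedAt
    congr!
  · intro a
    rcases ((rel D 0 c.2).filter fun t => item t = a).eq_empty_or_nonempty with h | ⟨t₁, h⟩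
    · rw [h]
      simp only [Finset.card_empty, Nat.cast_zero]
      linarith
    · have h1 := (Finset.mem_filter.mp h).2
      subst h1
      by_cases h0 : P c (key c.1 t₁) = 0
      · have hd := hA.degree_le c (key c.1 t₁)
        rw [h0, max_eq_left (by omega), mul_one] at hd
        rw [le_div_iff₀ hq]
        have hs : ((rel D 0 c.2).filter fun t => item t = item t₁).card ≤
            ((rel D 0 c.2).filter fun t => key c.1 t = key c.1 t₁).card := by
          refine Finset.card_le_card fun t ht => ?_
          rw [Finset.mem_filter] at ht ⊢
          refine ⟨ht.1, ?_⟩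
          have ht := ht.2
          simp only [hitem, h0, if_true] at ht
          split_ifs at ht
          · simpa using ht
          · simp at ht
        have : (((rel D 0 c.2).filter fun t => item t = item t₁).card * q : ℝ) ≤
            (q * ((rel D 0 c.2).filter fun t => key c.1 t = key c.1 t₁).card : ℕ) := by
          push_cast
          rw [mul_comm]
          gcongr
        exact this.trans (by exact_mod_cast hd)
      · refine le_trans ?_ hτ
        have : ((rel D 0 c.2).filter fun t => item t = item t₁) ⊆ {t₁} := by
          intro t ht
          have ht := (Finset.mem_filter.mp ht).2
          simp only [hitem, h0, if_false] at ht
          split_ifs at ht <;> simp at ht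
          simpa using ht
        exact_mod_cast (Finset.card_le_card this).trans_eq (Finset.card_singleton t₁)
  · have h1 := sum_card_target_le hA c ρ
    have h2 := hA.card_le 0 c.2
    -- Light tuples have one target each. The total `7 * m` is within the allowed `κ * τ * q = 9 *
    -- m`.
    have h3 : ∑ t ∈ rel D 0 c.2, (B (item t)).card ≤ m + 6 * m := by
      rw [← Finset.sum_filter_add_sum_filter_not _ (fun t => P c (key c.1 t) = 0)]
      refine add_le_add ?_ ?_
      · refine le_trans (Finset.sum_le_card_nsmul _ _ 1 fun t ht => ?_) ?_
        · simp [hB, hitem, (Finset.mem_filter.mp ht).2]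
        · simpa using (Finset.card_filter_le _ _).trans h2
      · refine le_trans (le_of_eq (Finset.sum_congr rfl fun t ht => ?_)) h1
        simp [hB, hitem, (Finset.mem_filter.mp ht).2]
    have h4 : ((∑ t ∈ rel D 0 c.2, (B (item t)).card : ℕ) : ℝ) ≤ ((m + 6 * m : ℕ) : ℝ) := by
      exact_mod_cast h3
    push_cast at h4
    rw [mul_assoc, threshold_mul]
    linarith

theorem ncard_lightAt_le (hA : Admissible q m D P) (hqm : q ≤ m) (i : Fin (j + 1)) (ρ : Fin q)
    (θ : ℝ) :
    (({ω : Hash j n q | θ * (3 * m / q) < ((lightAt D P ω i ρ).card : ℝ)}.ncard : ℕ) : ℝ) ≤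
      Real.exp 3 * (2 : ℝ) ^ (-θ) *
        (q : ℝ) ^ Fintype.card (Attr j × (Fin n ⊕ Fin n × Fin n)) := by
  classical
  have hq : (0 : ℝ) < q := by exact_mod_cast NeZero.pos q
  have hτ := threshold_ge_one hqm
  have := ncard_many_hits_le (NeZero.pos q)
    ((rel D 1 i).filter fun t => P (true, i) t.1 = 0)
    (fun t => (((true, i), .inl t.1) : Attr j × (Fin n ⊕ Fin n × Fin n))) (fun _ => {ρ})
    (τ := 3 * m / q) (by linarith) (κ := 3) ?_ ?_ θ
  · simp only [Finset.mem_singleton, Finset.filter_filter] at this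
    convert this using 7
    unfold lightAt
    congr!
  · intro a
    rcases (((rel D 1 i).filter fun t => P (true, i) t.1 = 0).filter fun t =>
      (((true, i), .inl t.1) : Attr j × (Fin n ⊕ Fin n × Fin n)) = a).eq_empty_or_nonempty
      with h | ⟨t₁, h⟩
    · rw [h]
      simp only [Finset.card_empty, Nat.cast_zero]
      linarith
    · have h1 := (Finset.mem_filter.mp h).2
      have h0 := (Finset.mem_filter.mp (Finset.mem_filter.mp h).1).2
      subst h1
      have hd := hA.degree_link_le i t₁.1 h0
      rw [le_div_iff₀ hq]
      have hs : (((rel D 1 i).filter fun t => P (true, i) t.1 = 0).filter fun t =>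
          (((true, i), .inl t.1) : Attr j × (Fin n ⊕ Fin n × Fin n)) =
            ((true, i), .inl t₁.1)).card ≤
          ((rel D 1 i).filter fun t => t.1 = t₁.1).card := by
        refine Finset.card_le_card fun t ht => ?_
        simp only [Finset.mem_filter, Prod.mk.injEq, Sum.inl.injEq, true_and] at ht ⊢
        exact ⟨ht.1.1, ht.2⟩
      calc _ ≤ (((rel D 1 i).filter fun t => t.1 = t₁.1).card : ℝ) * q :=
            mul_le_mul_of_nonneg_right (by exact_mod_cast hs) hq.le
        _ ≤ 3 * m := by rw [mul_comm]; exact_mod_cast hd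
  · have h2 : ((rel D 1 i).filter fun t => P (true, i) t.1 = 0).card ≤ m :=
      (Finset.card_filter_le _ _).trans (hA.card_le 1 i)
    have h3 : (((rel D 1 i).filter fun t => P (true, i) t.1 = 0).card : ℝ) ≤ m := by
      exact_mod_cast h2
    rw [mul_assoc, threshold_mul]
    simp
    linarith

theorem ncard_joinAt_le (hA : Admissible q m D P) (hqm : q ≤ m) (i : Fin (j + 1)) (ρ ρ' : Fin q)
    (θ : ℝ) :
    (({ω : Hash j n q | θ * (3 * m / q) < ((joinAt D P ω i ρ ρ').card : ℝ)}.ncard : ℕ) : ℝ) ≤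
      Real.exp 3 * (2 : ℝ) ^ (-θ) *
        (q : ℝ) ^ Fintype.card (Attr j × (Fin n ⊕ Fin n × Fin n)) := by
  classical
  have hτ := threshold_ge_one hqm
  set F := (rel D 1 i).filter fun t => Hosts P (true, i) t.1 ρ ∧ P (false, i + 1) t.2 = 0 with hF
  have := ncard_many_hits_le (NeZero.pos q) F
    (fun t => (((false, i + 1), .inl t.2) : Attr j × (Fin n ⊕ Fin n × Fin n))) (fun _ => {ρ'})
    (τ := 3 * m / q) (by linarith) (κ := 3) ?_ ?_ θ
  · simp only [Finset.mem_singleton, hF, Finset.filter_filter] at this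
    convert this using 7
    unfold joinAt
    congr!
  · intro a
    refine le_trans ?_ hτ
    norm_cast
    -- The first attribute is the one value hosted by `ρ`, so equal second attributes mean equal
    -- tuples. No degree bound for the second attribute of `O i` is needed.
    refine Finset.card_le_one.mpr fun t ht t' ht' => ?_
    simp only [hF, Finset.mem_filter] at ht ht'
    have h1 := ht.2.trans ht'.2.symm
    simp only [Prod.mk.injEq, Sum.inl.injEq, true_and] at h1
    exact Prod.ext (ht.1.2.1.unique (hA.sum_le _) ht'.1.2.1) h1
  · have h3 : (F.card : ℝ) ≤ m := by
      exact_mod_cast (Finset.card_filter_le _ _).trans (hA.card_le 1 i)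
    rw [mul_assoc, threshold_mul]
    simp
    linarith

/-- The hash functions that distribute the input evenly, up to the factor `θ`. -/
def IsBalanced (D : Finset (Record j n)) (P : Shares j n) (m : ℕ) (θ : ℝ) (ω : Hash j n q) :
    Prop :=
  (∀ c ρ, ((placedAt D P ω c ρ).card : ℝ) ≤ θ * (3 * m / q)) ∧
  (∀ i ρ, ((lightAt D P ω i ρ).card : ℝ) ≤ θ * (3 * m / q)) ∧
  ∀ i ρ ρ', ((joinAt D P ω i ρ ρ').card : ℝ) ≤ θ * (3 * m / q)

/-- Union bound over all attributes and coordinates; the pairs of coordinates in `joinAt` account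
for `q ^ 2`. -/
theorem le_ncard_isBalanced (hA : Admissible q m D P) (hqm : q ≤ m) (θ : ℝ) :
    (1 - 4 * (j + 1) * q ^ 2 * (Real.exp 3 * (2 : ℝ) ^ (-θ))) * Nat.card (Hash j n q) ≤
      ({ω : Hash j n q | IsBalanced D P m θ ω}.ncard : ℝ) := by
  classical
  set bad : (Attr j × Fin q) ⊕ (Fin (j + 1) × Fin q) ⊕ (Fin (j + 1) × Fin q × Fin q) →
      Set (Hash j n q) := fun e =>
    Sum.elim (fun e => {ω | θ * (3 * m / q) < ((placedAt D P ω e.1 e.2).card : ℝ)})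
      (Sum.elim (fun e => {ω | θ * (3 * m / q) < ((lightAt D P ω e.1 e.2).card : ℝ)})
        fun e => {ω | θ * (3 * m / q) < ((joinAt D P ω e.1 e.2.1 e.2.2).card : ℝ)}) e with hbad
  set δ : ℝ := Real.exp 3 * (2 : ℝ) ^ (-θ) with hδ
  have hcard : (Nat.card (Hash j n q) : ℝ) =
      (q : ℝ) ^ Fintype.card (Attr j × (Fin n ⊕ Fin n × Fin n)) := by
    rw [Nat.card_eq_fintype_card, Fintype.card_fun]
    simp
  have hb : ∀ e, ((bad e).ncard : ℝ) ≤ δ * Nat.card (Hash j n q) := by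
    rw [hcard]
    rintro (e | e | e)
    · exact ncard_placedAt_le hA hqm _ _ θ
    · exact ncard_lightAt_le hA hqm _ _ θ
    · exact ncard_joinAt_le hA hqm _ _ _ θ
  have hcompl : {ω : Hash j n q | IsBalanced D P m θ ω}ᶜ ⊆ ⋃ e ∈ Finset.univ, bad e := by
    intro ω hω
    by_contra h
    simp only [Finset.mem_univ, Set.iUnion_true, Set.mem_iUnion, not_exists] at h
    refine hω ⟨fun c ρ => ?_, fun i ρ => ?_, fun i ρ ρ' => ?_⟩
    · exact not_lt.mp (h (.inl (c, ρ)))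
    · exact not_lt.mp (h (.inr (.inl (i, ρ))))
    · exact not_lt.mp (h (.inr (.inr (i, ρ, ρ'))))
  have h1 : (({ω : Hash j n q | IsBalanced D P m θ ω}ᶜ).ncard : ℝ) ≤ ∑ e, ((bad e).ncard : ℝ) := by
    exact_mod_cast (Set.ncard_le_ncard hcompl (Set.toFinite _)).trans
      (Finset.set_ncard_biUnion_le _ _)
  have h2 : ∑ e, ((bad e).ncard : ℝ) ≤ 4 * (j + 1) * q ^ 2 * (δ * Nat.card (Hash j n q)) := by
    refine (Finset.sum_le_sum fun e _ => hb e).trans ?_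
    rw [Finset.sum_const, nsmul_eq_mul]
    refine mul_le_mul_of_nonneg_right ?_ (by positivity)
    simp only [Finset.card_univ, Fintype.card_sum, Fintype.card_prod, Fintype.card_fin,
      Fintype.card_bool]
    have hq : 1 ≤ q := NeZero.pos q
    have : 2 * (j + 1) * q + ((j + 1) * q + (j + 1) * (q * q)) ≤ 4 * (j + 1) * q ^ 2 := by
      nlinarith [Nat.mul_le_mul_left ((j + 1) * q) hq]
    exact_mod_cast this
  have h3 := Set.ncard_add_ncard_compl {ω : Hash j n q | IsBalanced D P m θ ω}
  have h4 : (({ω : Hash j n q | IsBalanced D P m θ ω}.ncard : ℝ) +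
      ({ω : Hash j n q | IsBalanced D P m θ ω}ᶜ).ncard) = Nat.card (Hash j n q) := by
    exact_mod_cast h3
  linarith

/-! ### Numbers of records received under a balanced hash function. -/

section Load

variable {θ : ℝ} {ω : Hash j n q}

-- The extra `1` is the only possible tuple with both attributes hosted, by `ρ` and `ρ'`
-- respectively; all others are counted by `joinAt`.
open Classical in
theorem card_hosts_covers_le (hA : Admissible q m D P) (hω : IsBalanced D P m θ ω)
    (i : Fin (j + 1)) (ρ ρ' : Fin q) :
    (((rel D 1 i).filter fun t => Hosts P (true, i) t.1 ρ ∧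
      Covers P ω (false, i + 1) t.2 ρ').card : ℝ) ≤ θ * (3 * m / q) + 1 := by
  set F := (rel D 1 i).filter fun t => Hosts P (true, i) t.1 ρ ∧ Hosts P (false, i + 1) t.2 ρ'
  have hF : F.card ≤ 1 := by
    refine Finset.card_le_one.mpr fun t ht t' ht' => ?_
    have ht := (Finset.mem_filter.mp ht).2
    have ht' := (Finset.mem_filter.mp ht').2
    exact Prod.ext (ht.1.unique (hA.sum_le _) ht'.1) (ht.2.unique (hA.sum_le _) ht'.2)
  have hsub : ((rel D 1 i).filter fun t => Hosts P (true, i) t.1 ρ ∧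
      Covers P ω (false, i + 1) t.2 ρ') ⊆ joinAt D P ω i ρ ρ' ∪ F := by
    intro t ht
    rw [Finset.mem_filter] at ht
    obtain ⟨h1, h2, h3 | h3⟩ := ht
    · exact Finset.mem_union_right _ (Finset.mem_filter.mpr ⟨h1, h2, h3⟩)
    · exact Finset.mem_union_left _ (Finset.mem_filter.mpr ⟨h1, ⟨h2, h3.1⟩, h3.2⟩)
  have h1 : ((joinAt D P ω i ρ ρ' ∪ F).card : ℝ) ≤ (joinAt D P ω i ρ ρ').card + F.card := by
    exact_mod_cast Finset.card_union_le _ _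
  have h2 : (F.card : ℝ) ≤ 1 := by exact_mod_cast hF
  have h3 := hω.2.2 i ρ ρ'
  have h4 : (((rel D 1 i).filter fun t => Hosts P (true, i) t.1 ρ ∧
      Covers P ω (false, i + 1) t.2 ρ').card : ℝ) ≤ (joinAt D P ω i ρ ρ' ∪ F).card := by
    exact_mod_cast Finset.card_le_card hsub
  linarith

variable (hA : Admissible q m D P) (hω : IsBalanced D P m θ ω) (hθ : 0 ≤ θ)
  (hD : ∀ i t, ((2, i, t) : Record j n) ∉ D)

include hA hω hθ hD

theorem card_firstReceived_le (σ : Coord j q) :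
    ((firstReceived D P ω σ).card : ℝ) ≤ 3 * (j + 1) * (2 * (θ * (3 * m / q)) + 1) := by
  classical
  have hN : 0 ≤ θ * (3 * m / q) := by positivity
  refine card_le_of_rel_le fun b i => ?_
  fin_cases b
  · have hsub : rel (firstReceived D P ω σ) 0 i ⊆ placedAt D P ω (false, i) (σ i) := by
      intro t ht
      simp only [rel, firstReceived, placedAt, FirstRecord, JoinRecord, Finset.mem_filter,
        Finset.mem_univ, true_and] at ht ⊢
      obtain ⟨h1, l, -, h2 | h2⟩ := ht
      · obtain ⟨rfl, h3⟩ := h2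
        exact ⟨h1, h3⟩
      · exact absurd h2.1 (by simp)
    have h1 := hω.1 (false, i) (σ i)
    have h2 : ((rel (firstReceived D P ω σ) 0 i).card : ℝ) ≤
      (placedAt D P ω (false, i) (σ i)).card := by exact_mod_cast Finset.card_le_card hsub
    simp only [Fin.zero_eta] at *
    linarith
  · have hsub : rel (firstReceived D P ω σ) 1 i ⊆ (rel D 1 i).filter fun t =>
        Hosts P (true, i) t.1 (σ i) ∧ Covers P ω (false, i + 1) t.2 (σ (i + 1)) := by
      intro t ht
      simp only [rel, firstReceived, FirstRecord, JoinRecord, Finset.mem_filter,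
        Finset.mem_univ, true_and] at ht ⊢
      obtain ⟨h1, l, -, h2 | h2⟩ := ht
      · exact absurd h2.1 (by simp)
      · obtain ⟨-, rfl, h3, h4⟩ := h2
        exact ⟨h1, h3, h4⟩
    have h1 := card_hosts_covers_le hA hω i (σ i) (σ (i + 1))
    have h2 : ((rel (firstReceived D P ω σ) 1 i).card : ℝ) ≤ ((rel D 1 i).filter fun t =>
        Hosts P (true, i) t.1 (σ i) ∧ Covers P ω (false, i + 1) t.2 (σ (i + 1))).card := by
      exact_mod_cast Finset.card_le_card hsub
    simp only [Fin.mk_one] at *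
    linarith
  · have hsub : rel (firstReceived D P ω σ) 2 i = ∅ := by
      ext t
      simp [rel, firstReceived, hD]
    simp only [Fin.reduceFinMk, hsub, Finset.card_empty, Nat.cast_zero]
    linarith

/-- The bound covers the worst of the three labels: `E i` placed by either attribute, `O i` as join
and light tuples plus the doubly hosted one, and marks, which are themselves placed tuples of `E i`.
-/
theorem card_lastReceived_le (σ : Coord j q) :
    ((lastReceived D P ω σ).card : ℝ) ≤ 3 * (j + 1) * (2 * (θ * (3 * m / q)) + 1) := by
  classical
  have hN : 0 ≤ θ * (3 * m / q) := by positivity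
  refine card_le_of_rel_le fun b i => ?_
  fin_cases b
  · have hsub : rel (lastReceived D P ω σ) 0 i ⊆
        placedAt D P ω (false, i) (σ i) ∪ placedAt D P ω (true, i) (σ i) := by
      intro t ht
      simp only [rel, lastReceived, placedAt, LastRecord, JoinRecord, Mark, Finset.mem_filter,
        Finset.mem_univ, true_and, Finset.mem_union] at ht ⊢
      rcases ht with ⟨h1, (h2 | h2) | h2 | h2⟩ | h2
      · obtain ⟨rfl, h3⟩ := h2
        exact Or.inl ⟨h1, h3⟩
      · exact absurd h2.1 (by simp)
      · exact Or.inr ⟨h1, h2.2⟩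
      · exact absurd h2.1 (by simp)
      · exact absurd h2.1 (by simp)
    have h1 := hω.1 (false, i) (σ i)
    have h2 := hω.1 (true, i) (σ i)
    have h3 : ((rel (lastReceived D P ω σ) 0 i).card : ℝ) ≤
        (placedAt D P ω (false, i) (σ i)).card + (placedAt D P ω (true, i) (σ i)).card := by
      exact_mod_cast (Finset.card_le_card hsub).trans (Finset.card_union_le _ _)
    simp only [Fin.zero_eta] at *
    linarith
  · have hsub : rel (lastReceived D P ω σ) 1 i ⊆ ((rel D 1 i).filter fun t =>
        Hosts P (true, i) t.1 (σ i) ∧ Covers P ω (false, i + 1) t.2 (σ (i + 1))) ∪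
        lightAt D P ω i (σ i) := by
      intro t ht
      simp only [rel, lastReceived, lightAt, LastRecord, JoinRecord, Mark, Finset.mem_filter,
        Finset.mem_univ, true_and, Finset.mem_union] at ht ⊢
      rcases ht with ⟨h1, (h2 | h2) | h2 | h2⟩ | h2
      · exact absurd h2.1 (by simp)
      · obtain ⟨-, h5, h3, h4⟩ := h2
        rw [h5]
        exact Or.inl ⟨h1, h3, h4⟩
      · exact absurd h2.1 (by simp)
      · exact Or.inr ⟨h1, h2⟩
      · exact absurd h2.1 (by simp)
    have h1 := card_hosts_covers_le hA hω i (σ i) (σ (i + 1))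
    have h2 := hω.2.1 i (σ i)
    have h3 : ((rel (lastReceived D P ω σ) 1 i).card : ℝ) ≤ ((rel D 1 i).filter fun t =>
        Hosts P (true, i) t.1 (σ i) ∧ Covers P ω (false, i + 1) t.2 (σ (i + 1))).card +
        (lightAt D P ω i (σ i)).card := by
      exact_mod_cast (Finset.card_le_card hsub).trans (Finset.card_union_le _ _)
    simp only [Fin.mk_one] at *
    linarith
  · have hsub : rel (lastReceived D P ω σ) 2 i ⊆ placedAt D P ω (true, i) (σ i) := by
      intro t ht
      simp only [rel, lastReceived, placedAt, Mark, Finset.mem_filter,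
        Finset.mem_univ, true_and, Finset.mem_union, hD, false_and, false_or] at ht ⊢
      exact ⟨ht.2.2.1, ht.2.1⟩
    have h1 := hω.1 (true, i) (σ i)
    have h2 : ((rel (lastReceived D P ω σ) 2 i).card : ℝ) ≤
      (placedAt D P ω (true, i) (σ i)).card := by exact_mod_cast Finset.card_le_card hsub
    simp only [Fin.reduceFinMk] at *
    linarith

end Load

end Zigzag

/-! ### Shares computed from the heavy-hitter statistics. -/

/-- The degree of a value as reported to the servers: only the heavy hitters are reported. -/
def reportedDegree (p m d : ℕ) : ℕ := if m ≤ p * d then d else 0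

theorem reportedDegree_le (p m d : ℕ) : reportedDegree p m d ≤ d := by
  unfold reportedDegree
  split_ifs <;> omega

/-- An unreported value has `p * d < m`, hence `q * d ≤ m`: since `q ≤ p`, the statistics reveal
every degree that matters. -/
theorem mul_le_of_mul_reportedDegree_le {p q m d B : ℕ} (hqp : q ≤ p) (hB : m ≤ B)
    (h : q * reportedDegree p m d ≤ B) : q * d ≤ B := by
  unfold reportedDegree at h
  split_ifs at h with h1
  · exact h
  · have := Nat.mul_le_mul_right d hqp
    omega

/-- The number of coordinates, out of `q`, that are dedicated to a value with the degree `e` in a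
relation of size `m`; the value counts as heavy also if the second degree `o` is large. -/
def shareCount (q m e o : ℕ) : ℕ :=
  if 3 * m < q * e ∨ 3 * m < q * o then q * e / (3 * m) + 1 else 0

/-- The added share costs `3 * m`, which is charged to whichever degree made the value heavy. Summed
over all values this gives `2 * m + m`, which is why the threshold is `3 * m`. -/
theorem mul_shareCount_le (q m e o : ℕ) : 3 * m * shareCount q m e o ≤ 2 * (q * e) + q * o := by
  unfold shareCount
  split_ifs with h
  · have := Nat.mul_div_le (q * e) (3 * m)
    rw [mul_add, mul_one]
    omega
  · simp

theorem le_mul_shareCount {q m e : ℕ} (o : ℕ) (hm : 0 < m) :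
    q * e ≤ 3 * m * max 1 (shareCount q m e o) := by
  unfold shareCount
  split_ifs with h
  · have := Nat.lt_mul_div_succ (q * e) (show 0 < 3 * m by omega)
    exact this.le.trans (Nat.mul_le_mul_left _ (le_max_right _ _))
  · simp
    omega

theorem le_of_shareCount_eq_zero {q m e o : ℕ} (h : shareCount q m e o = 0) : q * o ≤ 3 * m := by
  unfold shareCount at h
  split_ifs at h
  omega

theorem sum_shareCount_le {β : Type*} [Fintype β] {q m : ℕ} (hm : 0 < m) {e o : β → ℕ}
    (he : ∑ v, e v ≤ m) (ho : ∑ v, o v ≤ m) : ∑ v, shareCount q m (e v) (o v) ≤ q := by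
  refine Nat.le_of_mul_le_mul_left (c := 3 * m) ?_ (by omega)
  calc 3 * m * ∑ v, shareCount q m (e v) (o v)
      ≤ ∑ v, (2 * (q * e v) + q * o v) := by
        rw [Finset.mul_sum]
        exact Finset.sum_le_sum fun v _ => mul_shareCount_le _ _ _ _
    _ = q * (2 * ∑ v, e v + ∑ v, o v) := by
        rw [Finset.sum_add_distrib, ← Finset.mul_sum, ← Finset.mul_sum, ← Finset.mul_sum]
        ring
    _ ≤ q * (2 * m + m) := Nat.mul_le_mul_left _ (by omega)
    _ = 3 * m * q := by ring

theorem sum_card_filter_eq {α β : Type*} [Fintype β] [DecidableEq β] (F : Finset α) (f : α → β) :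
    ∑ v, (F.filter fun t => f t = v).card = F.card :=
  (Finset.card_eq_sum_card_fiberwise (fun _ _ => Finset.mem_coe.mpr (Finset.mem_univ _))).symm

/-! ### The line query as a zigzag query. -/

namespace LineQuery

open Zigzag

variable {k n p : ℕ}

/-- The relation of the line query that plays the role of `E i` in the zigzag query. It is reversed
if `k = 2 * i`. -/
def evenIndex (hk : 0 < k) (i : Fin (k / 2 + 1)) : Fin k := ⟨min (2 * i) (k - 1), by omega⟩

/-- Reverses the tuples of `E i` if `k = 2 * i`. -/
def orient (i : Fin (k / 2 + 1)) (t : Fin n × Fin n) : Fin n × Fin n :=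
  if 2 * i.val < k then t else t.swap

/-- The records of the zigzag query that belongs to an instance of the line query. -/
def IsRecord (hk : 0 < k) (S : BinaryInstance k n) (a : Record (k / 2) n) : Prop :=
  (a.1 = 0 ∧ orient a.2.1 a.2.2 ∈ S (evenIndex hk a.2.1)) ∨
  (a.1 = 1 ∧ ∃ h : 2 * a.2.1.val + 1 < k, a.2.2 ∈ S ⟨2 * a.2.1.val + 1, h⟩)

open Classical in
/-- The input of the zigzag query that belongs to an instance of the line query. -/
noncomputable def records (hk : 0 < k) (S : BinaryInstance k n) : Finset (Record (k / 2) n) :=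
  Finset.univ.filter (IsRecord hk S)

theorem mem_records {hk : 0 < k} {S : BinaryInstance k n} {a : Record (k / 2) n} :
    a ∈ records hk S ↔ IsRecord hk S a := by
  simp [records]

/-- The server that stores a record. -/
def recordOwner (hk : 0 < k) (owner : Fin k → Fin n × Fin n → Fin p) (a : Record (k / 2) n) :
    Fin p :=
  if h : a.1 = 1 ∧ 2 * a.2.1.val + 1 < k then owner ⟨2 * a.2.1.val + 1, h.2⟩ a.2.2
  else owner (evenIndex hk a.2.1) (orient a.2.1 a.2.2)

theorem mem_records_localPart {hk : 0 < k} {S : BinaryInstance k n}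
    {owner : Fin k → Fin n × Fin n → Fin p} (a : Record (k / 2) n) (s : Fin p) :
    a ∈ records hk (localPart S owner s) ↔ a ∈ records hk S ∧ recordOwner hk owner a = s := by
  simp only [mem_records, IsRecord, localPart, Finset.mem_filter, recordOwner]
  constructor
  · rintro (⟨h0, h1, h2⟩ | ⟨h0, h, h1, h2⟩)
    · simp [h0, h1, h2]
    · simp [h0, h, h1, h2]
  · rintro ⟨⟨h0, h1⟩ | ⟨h0, h, h1⟩, h2⟩
    · simp only [h0, Fin.reduceEq, false_and, dif_neg, not_false_eq_true] at h2
      exact Or.inl ⟨h0, h1, h2⟩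
    · simp only [h0, h, and_self, dif_pos] at h2
      exact Or.inr ⟨h0, h, h1, h2⟩

theorem two_notMem_records {hk : 0 < k} {S : BinaryInstance k n} (i : Fin (k / 2 + 1))
    (t : Fin n × Fin n) : ((2, i, t) : Record (k / 2) n) ∉ records hk S := by
  simp [mem_records, IsRecord]

/-- The sequence of values that belongs to an answer of the zigzag query. -/
def flatten (y : Fin (k / 2 + 1) → Fin n × Fin n) (l : Fin (k + 1)) : Fin n :=
  if l.val % 2 = 0 then (y ⟨l / 2, by omega⟩).1 else (y ⟨l / 2, by omega⟩).2

/-- Even atoms are read off the tuples of `E i`, odd ones off the links `O i`. For even `k` the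
second entry of the last tuple is ignored, as `O (j - 1)` already checks the last atom. -/
theorem flatten_mem_lineQuery {hk : 0 < k} {S : BinaryInstance k n}
    {y : Fin (k / 2 + 1) → Fin n × Fin n} (hy : y ∈ answers (records hk S)) :
    flatten y ∈ lineQuery S := by
  intro a
  obtain ⟨hE, hO⟩ := hy
  rcases Nat.even_or_odd' a.val with ⟨i, hi | hi⟩
  · have h1 := hE ⟨i, by omega⟩
    simp only [mem_records, IsRecord, orient, evenIndex, true_and, Fin.reduceEq, false_and,
      or_false, ← hi, a.2, if_true] at h1
    have h2 : min a.val (k - 1) = a.val := by omega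
    simp only [h2, Fin.eta] at h1
    have h3 : a.val % 2 = 0 := by omega
    have h4 : (a.val + 1) % 2 ≠ 0 := by omega
    have h5 : a.val / 2 = i := by omega
    have h6 : (a.val + 1) / 2 = i := by omega
    simpa [flatten, h3, h4, h5, h6] using h1
  · have hlast : (⟨i, by omega⟩ : Fin (k / 2 + 1)) ≠ Fin.last (k / 2) := by
      rw [Ne, Fin.ext_iff]
      simp only [Fin.val_last]
      omega
    have h1 := hO ⟨i, by omega⟩ hlast
    have h0 : (⟨i, by omega⟩ : Fin (k / 2 + 1)) + 1 = ⟨i + 1, by omega⟩ :=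
      Fin.ext (Fin.val_add_one_of_lt (Fin.lt_last_iff_ne_last.mpr hlast))
    simp only [mem_records, IsRecord, Fin.reduceEq, false_and, true_and, false_or, ← hi,
      Fin.eta, a.2, exists_true_left, h0] at h1
    have h3 : a.val % 2 ≠ 0 := by omega
    have h4 : (a.val + 1) % 2 = 0 := by omega
    have h5 : a.val / 2 = i := by omega
    have h6 : (a.val + 1) / 2 = i + 1 := by omega
    simpa [flatten, h3, h4, h5, h6] using h1

/-- The answer of the zigzag query that belongs to an answer of the line query. -/
def unflatten (hk : 0 < k) (x : Fin (k + 1) → Fin n) (i : Fin (k / 2 + 1)) : Fin n × Fin n :=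
  (x ⟨2 * i, by omega⟩, x ⟨if 2 * i.val < k then 2 * i + 1 else 2 * i - 1, by split_ifs <;> omega⟩)

theorem flatten_unflatten (hk : 0 < k) (x : Fin (k + 1) → Fin n) :
    flatten (unflatten hk x) = x := by
  funext l
  unfold flatten unflatten
  by_cases h1 : l.val % 2 = 0
  · rw [if_pos h1]
    exact congrArg x (Fin.ext (by simp only; omega))
  · rw [if_neg h1]
    exact congrArg x (Fin.ext (by simp only; split_ifs <;> omega))

theorem unflatten_mem_answers {hk : 0 < k} {S : BinaryInstance k n} {x : Fin (k + 1) → Fin n}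
    (hx : x ∈ lineQuery S) : unflatten hk x ∈ answers (records hk S) := by
  refine ⟨fun i => ?_, fun i hi => ?_⟩
  · simp only [mem_records, IsRecord, true_and, Fin.reduceEq, false_and, or_false]
    have := hx (evenIndex hk i)
    by_cases h : 2 * i.val < k
    · have h2 : min (2 * i.val) (k - 1) = 2 * i.val := by omega
      simpa [orient, unflatten, h, evenIndex, h2, Fin.castSucc, Fin.succ] using this
    · have h2 : min (2 * i.val) (k - 1) = 2 * i.val - 1 := by omega
      have h3 : 2 * i.val - 1 + 1 = 2 * i.val := by omega
      simpa [orient, unflatten, h, evenIndex, h2, h3, Fin.castSucc, Fin.succ] using this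
  · have hlt : i.val < k / 2 := Fin.val_lt_last hi
    have hv : (i + 1).val = i.val + 1 :=
      Fin.val_add_one_of_lt (Fin.lt_last_iff_ne_last.mpr hi)
    simp only [mem_records, IsRecord, true_and, Fin.reduceEq, false_and, false_or]
    have h1 : 2 * i.val + 1 < k := by omega
    have h2 : 2 * i.val < k := by omega
    have := hx ⟨2 * i.val + 1, h1⟩
    refine ⟨h1, ?_⟩
    simpa [unflatten, h2, hv, mul_add, Fin.castSucc, Fin.succ] using this

theorem image_flatten_answers (hk : 0 < k) (S : BinaryInstance k n) :
    flatten '' answers (records hk S) = lineQuery S :=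
  Set.Subset.antisymm (Set.image_subset_iff.mpr fun _ => flatten_mem_lineQuery)
    fun x hx => ⟨_, unflatten_mem_answers hx, flatten_unflatten hk x⟩

/-- The reported degree of a value in an attribute of `E i`. -/
def evenDegree (hk : 0 < k) (st : HeavyStats k n) (c : Attr (k / 2)) (v : Fin n) : ℕ :=
  if c.1 = decide (2 * c.2.val < k) then st.snd (evenIndex hk c.2) v
  else st.fst (evenIndex hk c.2) v

/-- The reported degree of a value in the first attribute of `O i`. -/
def oddDegree (st : HeavyStats k n) (i : Fin (k / 2 + 1)) (v : Fin n) : ℕ :=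
  if h : 2 * i.val + 1 < k then st.fst ⟨2 * i.val + 1, h⟩ v else 0

/-- The shares that are computed from the statistics. -/
def shares (hk : 0 < k) (q m : ℕ) (st : HeavyStats k n) : Shares (k / 2) n := fun c v =>
  shareCount q m (evenDegree hk st c v) (if c.1 then oddDegree st c.2 v else 0)

theorem rel_zero_records_of_lt (hk : 0 < k) (S : BinaryInstance k n) {i : Fin (k / 2 + 1)}
    (h : 2 * i.val < k) : rel (records hk S) 0 i = S (evenIndex hk i) := by
  ext t
  simp [rel, mem_records, IsRecord, orient, h]

theorem rel_zero_records_of_not_lt (hk : 0 < k) (S : BinaryInstance k n) {i : Fin (k / 2 + 1)}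
    (h : ¬ 2 * i.val < k) :
    rel (records hk S) 0 i = (S (evenIndex hk i)).map (Equiv.prodComm _ _).toEmbedding := by
  ext t
  simp [rel, mem_records, IsRecord, orient, h, Finset.mem_map_equiv]

theorem rel_one_records_of_lt (hk : 0 < k) (S : BinaryInstance k n) {i : Fin (k / 2 + 1)}
    (h : 2 * i.val + 1 < k) : rel (records hk S) 1 i = S ⟨2 * i.val + 1, h⟩ := by
  ext t
  simp [rel, mem_records, IsRecord, h]

theorem rel_one_records_of_not_lt (hk : 0 < k) (S : BinaryInstance k n) {i : Fin (k / 2 + 1)}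
    (h : ¬ 2 * i.val + 1 < k) : rel (records hk S) 1 i = ∅ := by
  ext t
  simp [rel, mem_records, IsRecord, h]

variable {m : ℕ} {S : BinaryInstance k n} (hS : ∀ i, (S i).card = m)

include hS

theorem evenDegree_heavyStats (hk : 0 < k) (c : Attr (k / 2)) (v : Fin n) :
    evenDegree hk (heavyStats p S) c v =
      reportedDegree p m ((rel (records hk S) 0 c.2).filter fun t => key c.1 t = v).card := by
  obtain ⟨b, i⟩ := c
  by_cases h : 2 * i.val < k
  · rw [rel_zero_records_of_lt hk S h]
    cases b <;> simp [evenDegree, h, heavyStats, reportedDegree, key, degreeFst, degreeSnd, hS]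
  · rw [rel_zero_records_of_not_lt hk S h]
    cases b <;> simp [evenDegree, h, heavyStats, reportedDegree, key, degreeFst, degreeSnd, hS,
      Finset.filter_map, comp_def] <;> congr!

theorem oddDegree_heavyStats (hk : 0 < k) (i : Fin (k / 2 + 1)) (v : Fin n) :
    oddDegree (heavyStats p S) i v =
      reportedDegree p m ((rel (records hk S) 1 i).filter fun t => t.1 = v).card := by
  by_cases h : 2 * i.val + 1 < k
  · rw [rel_one_records_of_lt hk S h]
    simp [oddDegree, h, heavyStats, reportedDegree, degreeFst, hS]
  · rw [rel_one_records_of_not_lt hk S h]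
    simp [oddDegree, h, reportedDegree]

theorem card_rel_records_le (hk : 0 < k) (b : Fin 3) (i : Fin (k / 2 + 1)) :
    (rel (records hk S) b i).card ≤ m := by
  fin_cases b
  · by_cases h : 2 * i.val < k
    · simp [rel_zero_records_of_lt hk S h, hS]
    · simp [rel_zero_records_of_not_lt hk S h, hS]
  · by_cases h : 2 * i.val + 1 < k
    · simp [rel_one_records_of_lt hk S h, hS]
    · simp [rel_one_records_of_not_lt hk S h]
  · simp [rel, two_notMem_records]

theorem admissible_shares (hk : 0 < k) {q : ℕ} (hqp : q ≤ p) (hm : 0 < m) :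
    Admissible q m (records hk S) (shares hk q m (heavyStats p S)) where
  sum_le := by
    rintro ⟨b, i⟩
    refine sum_shareCount_le hm ?_ ?_
    · refine (Finset.sum_le_sum fun v _ => ?_).trans ((sum_card_filter_eq _ (key b)).trans_le
        (card_rel_records_le hS hk 0 i))
      rw [evenDegree_heavyStats hS]
      exact reportedDegree_le _ _ _
    · cases b
      · simp
      · refine (Finset.sum_le_sum fun v _ => ?_).trans ((sum_card_filter_eq _ Prod.fst).trans_le
          (card_rel_records_le hS hk 1 i))
        simp only [if_true]
        rw [oddDegree_heavyStats hS hk]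
        exact reportedDegree_le _ _ _
  card_le := card_rel_records_le hS hk
  degree_le := by
    intro c v
    refine mul_le_of_mul_reportedDegree_le (p := p) (m := m) hqp ?_ ?_
    · calc m ≤ 3 * m * 1 := by omega
        _ ≤ _ := Nat.mul_le_mul_left _ (le_max_left _ _)
    · rw [← evenDegree_heavyStats hS]
      exact le_mul_shareCount _ hm
  degree_link_le := by
    intro i v h
    refine mul_le_of_mul_reportedDegree_le (p := p) (m := m) hqp (by omega) ?_
    rw [← oddDegree_heavyStats hS hk]
    exact le_of_shareCount_eq_zero h

end LineQuery

/-! ### Numerical estimates and assembly. -/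

theorem clog_two_le_two_mul_logb {n : ℕ} (hn : 2 ≤ n) :
    (Nat.clog 2 n : ℝ) ≤ 2 * Real.logb 2 n := by
  have hn' : (2 : ℝ) ≤ n := by exact_mod_cast hn
  have h1 : 1 ≤ Real.logb 2 n := by
    rw [Real.le_logb_iff_rpow_le one_lt_two (by linarith)]
    simpa using hn'
  have h2 : Nat.clog 2 n = ⌈Real.logb (2 : ℕ) n⌉₊ := (Real.natCeil_logb_natCast 2 n).symm
  rw [h2]
  have := Nat.ceil_lt_add_one (a := Real.logb (2 : ℕ) n) (by push_cast; linarith)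
  push_cast at this ⊢
  linarith

theorem exists_pow_le_and_rpow_le {p r : ℕ} (hp : 0 < p) (hr : 0 < r) :
    ∃ q : ℕ, 0 < q ∧ q ^ r ≤ p ∧ (p : ℝ) ^ ((1 : ℝ) / r) ≤ 2 * q := by
  have hp' : (1 : ℝ) ≤ p := by exact_mod_cast hp
  have h1 : (1 : ℝ) ≤ (p : ℝ) ^ ((1 : ℝ) / r) := Real.one_le_rpow hp' (by positivity)
  have hq : 0 < ⌊(p : ℝ) ^ ((1 : ℝ) / r)⌋₊ := Nat.floor_pos.mpr h1
  refine ⟨⌊(p : ℝ) ^ ((1 : ℝ) / r)⌋₊, hq, ?_, ?_⟩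
  · have h2 := Nat.floor_le (a := (p : ℝ) ^ ((1 : ℝ) / r)) (by positivity)
    have h3 : ((⌊(p : ℝ) ^ ((1 : ℝ) / r)⌋₊ : ℝ)) ^ r ≤ ((p : ℝ) ^ ((1 : ℝ) / r)) ^ r := by gcongr
    rw [one_div, Real.rpow_inv_natCast_pow (by linarith) hr.ne'] at h3
    rw [one_div]
    exact_mod_cast h3
  · have h2 := Nat.lt_floor_add_one ((p : ℝ) ^ ((1 : ℝ) / r))
    have h3 : (1 : ℝ) ≤ ⌊(p : ℝ) ^ ((1 : ℝ) / r)⌋₊ := by exact_mod_cast hq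
    linarith

namespace MPCProtocol

/-- The protocol without communication. -/
def silent {p : ℕ} {X St Y : Type} (f : X → Finset Y) : MPCProtocol p X St Y where
  rounds := 0
  Seed := Unit
  send _ _ _ _ _ _ := []
  output _ _ _ x _ := f x

theorem le_prob {p : ℕ} {X St Y : Type} (A : MPCProtocol p X St Y) {E F : Set A.Seed}
    (h : E ⊆ F) {δ : ℝ} (hE : (1 - δ) * Nat.card A.Seed ≤ E.ncard) : 1 - δ ≤ A.prob F := by
  have := A.seedFintype
  have := A.seedNonempty
  have hc : (0 : ℝ) < Nat.card A.Seed := by exact_mod_cast Nat.card_pos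
  unfold prob
  rw [le_div_iff₀ hc]
  refine hE.trans ?_
  exact_mod_cast Set.ncard_le_ncard h (Set.toFinite _)

end MPCProtocol

namespace LineQuery

open Zigzag

/-- The constant in the threshold for the failure probability `p ^ (-a)`. -/
noncomputable def thresholdConst (j a : ℕ) : ℝ :=
  Real.logb 2 (4 * (j + 1) * Real.exp 3) + (a + 2) / Real.log 2

/-- The factor by which the loads may exceed their averages, up to failure probability
`p ^ (-a)`. -/
noncomputable def threshold (j a p : ℕ) : ℝ :=
  Real.logb 2 (4 * (j + 1) * Real.exp 3 * (p : ℝ) ^ (a + 2))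

theorem two_le_const (j : ℕ) : (2 : ℝ) ≤ 4 * (j + 1) * Real.exp 3 := by
  have h1 : (1 : ℝ) ≤ Real.exp 3 := Real.one_le_exp (by norm_num)
  have h2 : (0 : ℝ) ≤ j := by positivity
  nlinarith

theorem one_le_threshold (j a : ℕ) {p : ℕ} (hp : 0 < p) : 1 ≤ threshold j a p := by
  have hp' : (1 : ℝ) ≤ (p : ℝ) ^ (a + 2) := one_le_pow₀ (by exact_mod_cast hp)
  have h := two_le_const j
  unfold threshold
  rw [Real.le_logb_iff_rpow_le one_lt_two (by positivity), Real.rpow_one]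
  nlinarith

theorem threshold_le (j a : ℕ) {p : ℕ} (hp : 0 < p) :
    threshold j a p ≤ thresholdConst j a * (1 + Real.log p) := by
  have hp' : (1 : ℝ) ≤ p := by exact_mod_cast hp
  have h := two_le_const j
  have h1 : 0 ≤ Real.logb 2 (4 * (j + 1) * Real.exp 3) :=
    Real.logb_nonneg one_lt_two (by linarith)
  have h2 : 0 ≤ Real.log p := Real.log_nonneg hp'
  have h3 : 0 < Real.log 2 := Real.log_pos one_lt_two
  unfold threshold thresholdConst
  rw [Real.logb_mul (by positivity) (by positivity)]
  have h4 : Real.logb 2 ((p : ℝ) ^ (a + 2)) = (a + 2) / Real.log 2 * Real.log p := by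
    rw [Real.logb, Real.log_pow]
    push_cast
    ring
  rw [h4]
  have h5 : 0 ≤ (a + 2) / Real.log 2 := by positivity
  nlinarith [mul_nonneg h1 h2]

/-- `threshold` is chosen so that the power of two cancels the constants; the two extra powers of
`p` absorb `q ^ 2`. -/
theorem failure_le (j a : ℕ) {p q : ℕ} (hp : 0 < p) (hqp : q ≤ p) :
    4 * (j + 1) * (q : ℝ) ^ 2 * (Real.exp 3 * (2 : ℝ) ^ (-threshold j a p)) ≤
      1 / (p : ℝ) ^ a := by
  have hp' : (0 : ℝ) < p := by exact_mod_cast hp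
  have hqp' : (q : ℝ) ≤ p := by exact_mod_cast hqp
  unfold threshold
  rw [Real.rpow_neg two_pos.le, Real.rpow_logb two_pos (by norm_num) (by positivity)]
  have : 4 * (j + 1) * (q : ℝ) ^ 2 * (Real.exp 3 * (4 * (j + 1) * Real.exp 3 *
      (p : ℝ) ^ (a + 2))⁻¹) = (q : ℝ) ^ 2 / ((p : ℝ) ^ 2 * (p : ℝ) ^ a) := by
    rw [pow_add]
    field_simp
  rw [this, ← div_div]
  gcongr
  rw [div_le_one (by positivity)]
  gcongr

/-- The constant factor in the load for the failure probability `p ^ (-a)`. -/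
noncomputable def loadConst (k a : ℕ) : ℝ :=
  27 * (k / 2 + 1 : ℕ) * (3 * (k / 2 : ℕ) + 7) * thresholdConst (k / 2) a

theorem load_bound {j a p q m n w : ℕ} (hp : 0 < p) (hq : 0 < q) (hqm : q ≤ m) (hn : 2 ≤ n)
    (hpq : (p : ℝ) ^ ((1 : ℝ) / (j + 1 : ℕ)) ≤ 2 * q) (hw : w = 3 * j + 3 + 2 * Nat.clog 2 n) :
    3 * (j + 1) * (2 * (threshold j a p * (3 * m / q)) + 1) * w ≤
      27 * (j + 1 : ℕ) * (3 * j + 7) * thresholdConst j a * (1 + Real.log p) ^ 1 *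
        (relationBits m n / (p : ℝ) ^ ((1 : ℝ) / (j + 1 : ℕ))) := by
  have hp' : (1 : ℝ) ≤ p := by exact_mod_cast hp
  have hq' : (0 : ℝ) < q := by exact_mod_cast hq
  have hqm' : (q : ℝ) ≤ m := by exact_mod_cast hqm
  have hn' : (2 : ℝ) ≤ n := by exact_mod_cast hn
  have hL : 1 ≤ Real.logb 2 n := by
    rw [Real.le_logb_iff_rpow_le one_lt_two (by linarith)]
    simpa using hn'
  set L := Real.logb 2 n
  set θ := threshold j a p
  set K := thresholdConst j a * (1 + Real.log p) with hK
  have hθ : 1 ≤ θ := one_le_threshold j a hp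
  have hθK : θ ≤ K := threshold_le j a hp
  have hwL : (w : ℝ) ≤ (3 * j + 7) * L := by
    have h := clog_two_le_two_mul_logb hn
    have hj : (0 : ℝ) ≤ j := by positivity
    rw [hw]
    push_cast
    nlinarith
  set R := (p : ℝ) ^ ((1 : ℝ) / (j + 1 : ℕ))
  have hR : 0 < R := by positivity
  -- The `1` is absorbed because `θ` and `m / q` are both at least 1.
  have h1 : 2 * (θ * (3 * m / q)) + 1 ≤ 9 * θ * (m / q) := by
    have h : 1 ≤ (m : ℝ) / q := by rwa [one_le_div hq']
    have : 2 * (θ * (3 * m / q)) = 6 * θ * (m / q) := by ring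
    rw [this]
    nlinarith
  have h2 : (m : ℝ) / q ≤ 2 * m / R := by
    rw [div_le_div_iff₀ hq' hR]
    have : (0 : ℝ) ≤ m := by positivity
    nlinarith
  have hK0 : 0 ≤ K := by linarith
  calc 3 * (j + 1) * (2 * (θ * (3 * m / q)) + 1) * w
      ≤ 3 * (j + 1) * (9 * K * (2 * m / R)) * ((3 * j + 7) * L) := by
        refine mul_le_mul (mul_le_mul_of_nonneg_left ?_ (by positivity)) hwL (by positivity)
          (by positivity)
        refine h1.trans ?_
        refine mul_le_mul (by linarith) h2 (by positivity) (by positivity)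
    _ = _ := by
        rw [relationBits, hK]
        push_cast
        ring

theorem exists_embedding_record (j n : ℕ) :
    Nonempty (Record j n ↪ (Fin (3 * j + 3 + 2 * Nat.clog 2 n) → Bool)) := by
  refine Embedding.nonempty_of_card_le ?_
  have h1 : n ≤ 2 ^ Nat.clog 2 n := Nat.le_pow_clog one_lt_two n
  have h2 : 3 * j + 3 < 2 ^ (3 * j + 3) := Nat.lt_two_pow_self
  simp only [Fintype.card_prod, Fintype.card_fin, Fintype.card_fun, Fintype.card_bool]
  calc 3 * ((j + 1) * (n * n)) = (3 * j + 3) * (n * n) := by ring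
    _ ≤ 2 ^ (3 * j + 3) * (2 ^ Nat.clog 2 n * 2 ^ Nat.clog 2 n) :=
        Nat.mul_le_mul h2.le (Nat.mul_le_mul h1 h1)
    _ = _ := by rw [← pow_add, ← pow_add, two_mul]

theorem exists_protocol_of_two_le {k : ℕ} (hk : 2 ≤ k) {p : ℕ} (hp : 2 ≤ p) (m n : ℕ) :
    ∃ A : LineProtocol k p n, A.rounds ≤ k / 2 ∧ (p ≤ m →
      ∀ S : BinaryInstance k n, (∀ j, (S j).card = m) →
      ∀ owner : Fin k → Fin n × Fin n → Fin p,
        (∀ ω, A.result ω (heavyStats p S) (localPart S owner) = lineQuery S) ∧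
        ∀ a : ℕ, 1 - 1 / (p : ℝ) ^ a ≤ A.prob
          {ω | (A.load ω (heavyStats p S) (localPart S owner) : ℝ) ≤
            loadConst k a * (1 + Real.log p) ^ 1 *
              (relationBits m n / (p : ℝ) ^ ((1 : ℝ) / (k / 2 + 1 : ℕ)))}) := by
  classical
  have hk0 : 0 < k := by omega
  obtain ⟨q, hq, hqp, hpq⟩ := exists_pow_le_and_rpow_le (p := p) (r := k / 2 + 1) (by omega)
    (by omega)
  have : NeZero q := ⟨hq.ne'⟩
  obtain ⟨sec⟩ : Nonempty (Coord (k / 2) q ↪ Fin p) :=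
    Embedding.nonempty_of_card_le (by simpa using hqp)
  obtain ⟨code⟩ := exists_embedding_record (k / 2) n
  have hqp' : q ≤ p := (Nat.le_self_pow (by omega) q).trans hqp
  refine ⟨(protocol code sec).comap (records hk0) (shares hk0 q m) (Finset.image flatten),
    min_le_left _ _, fun hpm S hS owner => ?_⟩
  have hm : 0 < m := by omega
  have hA : Admissible q m (records hk0 S) (shares hk0 q m (heavyStats p S)) :=
    admissible_shares hS hk0 hqp' hm
  have hx : ∀ a s, a ∈ (records hk0 ∘ localPart S owner) s ↔
      a ∈ records hk0 S ∧ recordOwner hk0 owner a = s := mem_records_localPart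
  -- A relation with `m ≥ p ≥ 2` tuples needs two values; this makes `logb 2 n ≥ 1`, so the label
  -- bits count as a constant factor.
  have hn : 2 ≤ n := by
    by_contra hn
    have h1 : (S ⟨0, hk0⟩).card ≤ n * n := by
      simpa using Finset.card_le_univ (S ⟨0, hk0⟩)
    rw [hS] at h1
    have : n * n ≤ 1 * 1 := Nat.mul_le_mul (by omega) (by omega)
    omega
  refine ⟨fun ω => ?_, fun a => ?_⟩
  · refine (MPCProtocol.result_comap (protocol code sec) _ _ _ ω _ _).trans ?_
    simp only [Finset.coe_image]
    rw [← Set.image_iUnion, ← image_flatten_answers hk0 S]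
    congr 1
    exact result_protocol (ω := ω) hx (by omega) code (by omega) hA.sum_le
      two_notMem_records
  · refine MPCProtocol.le_prob _ (E := {ω : Hash (k / 2) n q | IsBalanced (records hk0 S)
      (shares hk0 q m (heavyStats p S)) m (threshold (k / 2) a p) ω}) ?_ ?_
    · intro ω hω
      have hθ : 0 ≤ threshold (k / 2) a p :=
        zero_le_one.trans (one_le_threshold _ _ (by omega))
      have hload := MPCProtocol.load_comap (protocol code sec) (records hk0) (shares hk0 q m)
        (Finset.image flatten) ω (heavyStats p S) (localPart S owner)
      refine (congrArg (Nat.cast (R := ℝ)) hload).trans_le ?_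
      refine (load_protocol_le hx (by omega) code (by omega) two_notMem_records (by positivity)
        (fun σ => card_firstReceived_le hA hω hθ two_notMem_records σ)
        (fun σ => card_lastReceived_le hA hω hθ two_notMem_records σ)).trans ?_
      exact load_bound (by omega) hq (hqp'.trans hpm) hn hpq rfl
    · refine le_trans ?_ (le_ncard_isBalanced hA (hqp'.trans hpm) (threshold (k / 2) a p))
      refine mul_le_mul_of_nonneg_right ?_ (Nat.cast_nonneg _)
      have := failure_le (k / 2) a (by omega : 0 < p) hqp'
      linarith

end LineQuery

theorem mainTheorem5 (k : ℕ) (hk : 2 ≤ k) :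
    ∃ (A : ∀ p _m n : ℕ, LineProtocol k p n) (c : ℕ),
      (∀ p m n : ℕ, (A p m n).rounds ≤ k / 2) ∧
      ∀ a : ℕ, ∃ C : ℝ, ∀ p m n : ℕ, 1 ≤ p → p ≤ m →
        ∀ S : BinaryInstance k n, (∀ j, (S j).card = m) →
        ∀ owner : Fin k → Fin n × Fin n → Fin p, IsUniformPartition S owner →
          (∀ ω, (A p m n).result ω (heavyStats p S) (localPart S owner) = lineQuery S) ∧
          1 - 1 / (p : ℝ) ^ a ≤ (A p m n).prob
            {ω | ((A p m n).load ω (heavyStats p S) (localPart S owner) : ℝ) ≤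
              C * (1 + Real.log p) ^ c *
                (relationBits m n / (p : ℝ) ^ ((1 : ℝ) / (((k + 1) ⌈/⌉ 2 : ℕ) : ℝ)))} := by
  classical
  have hceil : (k + 1) ⌈/⌉ 2 = k / 2 + 1 := by
    rw [Nat.ceilDiv_eq_add_pred_div]
    omega
  have key : ∀ p m n : ℕ, ∃ A : LineProtocol k p n, A.rounds ≤ k / 2 ∧ (1 ≤ p → p ≤ m →
      ∀ S : BinaryInstance k n, (∀ j, (S j).card = m) →
      ∀ owner : Fin k → Fin n × Fin n → Fin p,
        (∀ ω, A.result ω (heavyStats p S) (localPart S owner) = lineQuery S) ∧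
        ∀ a : ℕ, 1 - 1 / (p : ℝ) ^ a ≤ A.prob
          {ω | (A.load ω (heavyStats p S) (localPart S owner) : ℝ) ≤
            LineQuery.loadConst k a * (1 + Real.log p) ^ 1 *
              (relationBits m n / (p : ℝ) ^ ((1 : ℝ) / (k / 2 + 1 : ℕ)))}) := by
    intro p m n
    by_cases hp : 2 ≤ p
    · obtain ⟨A, h1, h2⟩ := LineQuery.exists_protocol_of_two_le hk hp m n
      exact ⟨A, h1, fun _ => h2⟩
    -- A single server holds the whole input and answers without communication; the probability
    -- bound is then `0`.
    · refine ⟨MPCProtocol.silent fun x => (lineQuery x).toFinset, Nat.zero_le _,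
        fun hp1 _ S _ owner => ⟨fun ω => ?_, fun a => ?_⟩⟩
      · obtain rfl : p = 1 := by omega
        have hloc : localPart S owner = fun _ => S := by
          funext s j
          exact Finset.filter_true_of_mem fun _ _ => Subsingleton.elim _ _
        simp [MPCProtocol.result, MPCProtocol.silent, hloc, Set.iUnion_const]
      · obtain rfl : p = 1 := by omega
        have h : (1 : ℝ) - 1 / ((1 : ℕ) : ℝ) ^ a = 0 := by simp
        rw [h]
        unfold MPCProtocol.prob
        positivity
  choose A hrounds hA using key
  refine ⟨A, 1, hrounds, fun a => ⟨LineQuery.loadConst k a, fun p m n hp hpm S hS owner _ => ?_⟩⟩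
  obtain ⟨h1, h2⟩ := hA p m n hp hpm S hS owner
  rw [hceil]
  exact ⟨h1, h2 a⟩
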